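/- Theorem. An itemset over $K$ attributes is a subset $S\subseteq\{1,\dots,K\}$; the frequency of $S$ under a probability distribution $p$ on $\{0,1\}^K$ is $p(S=1)=\sum_{\omega:\ \omega_a=1\ \forall a\in S}p(\omega)$. An instance of MaxQueryDec consists of $K$, a family $\mathcal F=\{B_1,\dots,B_N\}$ of $N$ distinct itemsets that is antimonotonic (it contains all subsets of each of its members), rational numbers $\theta_1,\dots,\theta_N$ that are consistent (some distribution $p$ on $\{0,1\}^K$ satisfies the frequencies, i.e. $p(B_i=1)=\theta_i$ for all $i$), an itemset $B$ and a rational threshold $b$. It is a yes-instance if some distribution satisfying the frequencies $\theta$ gives $B$ a frequency larger than $b$. Itemsets are encoded as 0-1 vectors of length $K$, and rational numbers as fractions of binary integers, not necessarily in lowest terms. (i) MaxQueryDec, i.e. the language of the encodings of all yes-instances, is in NP: there are a polynomial $p$ and a verifier running in polynomial time on a Turing machine such that a string $x$ is in the language if and only if the verifier accepts $(x,w)$ for some binary string $w$ of length at most $p(|x|)$. (ii) There is a polynomial $P$ such that every instance in which the reduced denominator of every $\theta_i$ has at most $L$ bits has a canonical optimal distribution: a distribution $q$ on $\{0,1\}^K$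 with rational entries that satisfies the frequencies $\theta$ and has the maximal frequency of $B$ among all distributions satisfying them, that has at most $N+1$ nonzero entries, and whose entries have (reduced) numerators and denominators of at most $P(N+L)$ bits. -/

import Mathlib

open Computability Turing

/-- A language `L` over the alphabet `Γ` is in NP: there are a verifier `V`, computed by a Turing
machine in time polynomial in the length of its input `(x, w)`, and a polynomial `p` such that
`x ∈ L` exactly when `V` accepts `(x, w)` for some binary certificate `w` of length at most
`p (|x|)`. The pair `(x, w)` is written on the input tape as `x` followed by `w`, in disjoint
copies of the two alphabets. -/
def InNP {Γ : Type} [Finite Γ] (L : Language Γ) : Prop :=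
  ∃ (V : List Γ × List Bool → Bool) (p : Polynomial ℕ),
    Nonempty (TM2ComputableInPolyTime
      (encodingProd (encodingList Γ) (encodingList Bool)).encode encodeBool V) ∧
    ∀ x : List Γ, x ∈ L ↔ ∃ w : List Bool, w.length ≤ p.eval x.length ∧ V (x, w) = true

/-- The frequency `p(S = 1)` of the itemset `S` under a weight function `p` on `{0,1}^K`. -/
def frequency {R : Type*} [AddCommMonoid R] {K : ℕ} (p : (Fin K → Bool) → R)
    (S : Finset (Fin K)) : R :=
  ∑ ω : Fin K → Bool with ∀ a ∈ S, ω a = true, p ω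

/-- A rational number given by a fraction, which need not be in lowest terms. -/
structure Fraction where
  num : ℤ
  den : ℕ
  den_pos : 0 < den

/-- The rational number that a fraction represents. -/
def Fraction.val (r : Fraction) : ℚ := (r.num : ℚ) / (r.den : ℚ)

/-- The data of a query: `K` attributes, `N` itemsets with a rational number attached to each of
them, a query itemset and a rational threshold. -/
structure QueryData where
  K : ℕ
  N : ℕ
  family : Fin N → Finset (Fin K)
  freq : Fin N → Fraction
  query : Finset (Fin K)
  threshold : Fraction

namespace QueryData

/-- `p` is a probability distribution on `{0,1}^K` that satisfies the given frequencies. -/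
def Satisfies (I : QueryData) (p : (Fin I.K → Bool) → ℝ) : Prop :=
  p ∈ stdSimplex ℝ (Fin I.K → Bool) ∧ ∀ i, frequency p (I.family i) = ((I.freq i).val : ℝ)

/-- The data form an instance of the query problem: the `N` itemsets are distinct, they form an
antimonotonic (downward closed) family, and the frequencies are consistent. -/
structure IsInstance (I : QueryData) : Prop where
  distinct : Function.Injective I.family
  antimonotonic : ∀ i, ∀ T ⊆ I.family i, ∃ j, I.family j = T
  consistent : ∃ p, I.Satisfies p

/-- `p` satisfies the frequencies and produces the maximal frequency for the query itemset. -/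
def IsOptimal (I : QueryData) (p : (Fin I.K → Bool) → ℝ) : Prop :=
  I.Satisfies p ∧ ∀ p', I.Satisfies p' → frequency p' I.query ≤ frequency p I.query

/-- A binary word followed by the separator `none`. -/
def encodeWord (l : List Bool) : List (Option Bool) := l.map some ++ [none]

/-- An itemset as its characteristic vector of length `K`. -/
def itemsetBits {K : ℕ} (S : Finset (Fin K)) : List Bool := List.ofFn fun a => decide (a ∈ S)

/-- An itemset and a fraction, as three words: the characteristic vector of the itemset, the sign
and the binary expansion of the numerator, and the binary expansion of the denominator. -/
def entryWords {K : ℕ} (S : Finset (Fin K)) (r : Fraction) : List (List Bool) :=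
  [itemsetBits S, decide (r.num < 0) :: encodeNat r.num.natAbs, encodeNat r.den]

/-- The words that describe the data: query and threshold, then the itemsets with frequencies. -/
def words (I : QueryData) : List (List Bool) :=
  entryWords I.query I.threshold ++
    (List.ofFn fun i => entryWords (I.family i) (I.freq i)).flatten

/-- The data as a string over the alphabet consisting of two bits and a separator. -/
def encode (I : QueryData) : List (Option Bool) := (I.words.map encodeWord).flatten

theorem encodeWord_append_inj {a b : List Bool} {s t : List (Option Bool)}
    (h : encodeWord a ++ s = encodeWord b ++ t) : a = b ∧ s = t := by
  induction a generalizing b with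
  | nil => cases b <;> simp_all [encodeWord]
  | cons x a ih =>
    cases b with
    | nil => simp [encodeWord] at h
    | cons y b =>
      simp only [encodeWord, List.map_cons, List.cons_append, List.cons.injEq,
        Option.some.injEq] at h
      obtain ⟨h1, h2⟩ := ih (b := b) (by simpa [encodeWord] using h.2)
      exact ⟨by rw [h.1, h1], h2⟩

theorem flatten_encodeWord_inj : ∀ {l m : List (List Bool)},
    (l.map encodeWord).flatten = (m.map encodeWord).flatten → l = m
  | [], [], _ => rfl
  | [], b :: m, h => by simp [encodeWord] at h
  | a :: l, [], h => by simp [encodeWord] at h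
  | a :: l, b :: m, h => by
    simp only [List.map_cons, List.flatten_cons] at h
    obtain ⟨h1, h2⟩ := encodeWord_append_inj h
    rw [h1, flatten_encodeWord_inj h2]

theorem entryWords_inj {K : ℕ} {S T : Finset (Fin K)} {r s : Fraction}
    (h : entryWords S r = entryWords T s) : S = T ∧ r = s := by
  have hinj : Function.Injective encodeNat := encodingNatBool.encode_injective
  simp only [entryWords, List.cons.injEq, decide_eq_decide, and_true, itemsetBits,
    List.ofFn_inj] at h
  obtain ⟨h1, ⟨h2, h3⟩, h4⟩ := h
  refine ⟨?_, ?_⟩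
  · ext a
    simpa using congrFun h1 a
  · obtain ⟨n, d, hd⟩ := r
    obtain ⟨n', d', hd'⟩ := s
    have h5 : n.natAbs = n'.natAbs := hinj h3
    obtain rfl : d = d' := hinj h4
    simp only at h2
    obtain rfl : n = n' := by omega
    rfl

theorem flatten_entryWords_inj {K : ℕ} : ∀ {l m : List (Finset (Fin K) × Fraction)},
    (l.map fun e => entryWords e.1 e.2).flatten = (m.map fun e => entryWords e.1 e.2).flatten →
      l = m
  | [], [], _ => rfl
  | [], b :: m, h => by simp [entryWords] at h
  | a :: l, [], h => by simp [entryWords] at h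
  | (S, r) :: l, (T, s) :: m, h => by
    simp only [List.map_cons, List.flatten_cons] at h
    obtain ⟨h1, h2⟩ := List.append_inj h (by simp [entryWords])
    obtain ⟨rfl, rfl⟩ := entryWords_inj h1
    rw [flatten_entryWords_inj h2]

/-- Distinct data have distinct encodings. -/
theorem encode_injective : Function.Injective encode := by
  intro I J h
  have h := flatten_encodeWord_inj h
  obtain ⟨K, N, F, θ, B, b⟩ := I
  obtain ⟨K', N', F', θ', B', b'⟩ := J
  simp only [words] at h
  obtain ⟨h1, h2⟩ := List.append_inj h (by simp [entryWords])
  obtain rfl : K = K' := by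
    simpa [entryWords, itemsetBits] using congrArg (fun l => (l.headD []).length) h1
  obtain ⟨rfl, rfl⟩ := entryWords_inj h1
  have h3 := flatten_entryWords_inj (l := List.ofFn fun i => (F i, θ i))
    (m := List.ofFn fun i => (F' i, θ' i)) (by simpa [List.map_ofFn, Function.comp_def] using h2)
  obtain rfl : N = N' := by simpa using congrArg List.length h3
  have h4 := List.ofFn_injective h3
  obtain rfl : F = F' := funext fun i => congrArg Prod.fst (congrFun h4 i)
  obtain rfl : θ = θ' := funext fun i => congrArg Prod.snd (congrFun h4 i)
  rfl

end QueryData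

/-- The decision problem as a language: the encodings of the instances for which some
distribution satisfying the frequencies gives the query itemset a frequency larger than the
threshold. -/
def MaxQueryDec : Language (Option Bool) :=
  {s | ∃ I : QueryData, I.encode = s ∧ I.IsInstance ∧
    ∃ p, I.Satisfies p ∧ (I.threshold.val : ℝ) < frequency p I.query}

/-! Part (ii) is linear programming. The distributions satisfying the frequencies are the
nonnegative solutions of `N + 1` linear equations with coefficients 0 and 1, one for each itemset
and one for the total mass. The mass equation makes this set compact, so optima exist; take one of
minimal support. If the columns on its support were dependent, a move along a kernel vector, with
the sign chosen so that the objective does not drop, would make a coordinate vanish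
(`exists_smaller_support`). So these columns are independent (`exists_optimal_linearIndependent`),
and there are at most `N + 1` of them. Cramer's rule for their Gram matrix, whose determinant is at
most `(N + 1)! * (N + 1) ^ (N + 1)`, yields a common denominator with polynomially many bits
(`exists_common_denominator`, `denominator_lt`).

For part (i), this optimum serves as the certificate, written as at most `N + 1` outcomes with
natural weights that are to be divided by their sum. The verifier checks that the string is an
encoding, that the itemsets are distinct and the family is closed under removing one element, and,
by cross-multiplication, that the frequencies are met and the threshold is exceeded. The certified
distribution also witnesses consistency, so nothing has to be promised about the input.

Most of the work is to run this verifier in polynomial time on a stack machine. All data are coded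
by binary trees in prefix notation. Such a code delimits itself: a counter detects its end, so the
topmost tree of a stack can be moved, copied and exchanged. The relation `PolyTime` between indexed
families is closed under composition, pairing, case distinction and loops with bounded states; folds
and arithmetic follow. `PolyTime.verifier` is assembled from these rules, and
`PolyTime.tm2Computable` turns it into a Turing machine. -/

/-! ### Program fragments for stack machines -/

/-- The symbols of the input tape: an instance symbol or a certificate bit. -/
abbrev InputSymbol := Option Bool ⊕ Bool

/-- The stacks of the machine: the input, the main stack, two auxiliary stacks and a counter. -/
inductive Stack
  | input | main | left | right | count
  deriving DecidableEq

instance : Fintype Stack :=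
  ⟨{.input, .main, .left, .right, .count}, fun k => by cases k <;> simp⟩

/-- The alphabets of the stacks. -/
@[reducible] def Alphabet : Stack → Type
  | .input => InputSymbol
  | .main => Bool
  | .left => Bool
  | .right => Bool
  | .count => Bool

/-- The internal memory of the machine holds the symbol that was read last. -/
abbrev Register := Option InputSymbol

/-- The contents of all stacks. -/
abbrev Memory := ∀ k, List (Alphabet k)

/-- The memory with the given contents of the five stacks. -/
def memory (i : List InputSymbol) (m l r c : List Bool) : Memory
  | .input => i
  | .main => m
  | .left => l
  | .right => r
  | .count => c

section memory
variable (i i' : List InputSymbol) (m l r c s : List Bool)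

@[simp] theorem memory_input : memory i m l r c .input = i := rfl
@[simp] theorem memory_main : memory i m l r c .main = m := rfl
@[simp] theorem memory_left : memory i m l r c .left = l := rfl
@[simp] theorem memory_right : memory i m l r c .right = r := rfl
@[simp] theorem memory_count : memory i m l r c .count = c := rfl

@[simp] theorem update_memory_input :
    Function.update (memory i m l r c) .input i' = memory i' m l r c := by
  funext k; cases k <;> rfl

@[simp] theorem update_memory_main :
    Function.update (memory i m l r c) .main s = memory i s l r c := by
  funext k; cases k <;> rfl

@[simp] theorem update_memory_left :
    Function.update (memory i m l r c) .left s = memory i m s r c := by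
  funext k; cases k <;> rfl

@[simp] theorem update_memory_right :
    Function.update (memory i m l r c) .right s = memory i m l s c := by
  funext k; cases k <;> rfl

@[simp] theorem update_memory_count :
    Function.update (memory i m l r c) .count s = memory i m l r s := by
  funext k; cases k <;> rfl

end memory

/-- Relabel the jump targets of a statement. -/
def mapLabel {Λ Λ' : Type} (φ : Λ → Λ') :
    TM2.Stmt Alphabet Λ Register → TM2.Stmt Alphabet Λ' Register
  | .push k f q => .push k f (mapLabel φ q)
  | .peek k f q => .peek k f (mapLabel φ q)
  | .pop k f q => .pop k f (mapLabel φ q)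
  | .load f q => .load f (mapLabel φ q)
  | .branch f q q' => .branch f (mapLabel φ q) (mapLabel φ q')
  | .goto f => .goto fun v => φ (f v)
  | .halt => .halt

/-- Relabel a configuration. -/
def mapCfg {Λ Λ' : Type} (φ : Λ → Λ') (c : TM2.Cfg Alphabet Λ Register) :
    TM2.Cfg Alphabet Λ' Register :=
  ⟨c.l.map φ, c.var, c.stk⟩

/-- Executing a statement never inspects its jump targets. All composition of fragments by
relabelling rests on this. -/
theorem stepAux_mapLabel {Λ Λ' : Type} (φ : Λ → Λ') (q : TM2.Stmt Alphabet Λ Register)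
    (v : Register) (S : Memory) :
    TM2.stepAux (mapLabel φ q) v S = mapCfg φ (TM2.stepAux q v S) := by
  induction q generalizing v S with
  | branch f q q' ih ih' =>
    simp only [mapLabel, TM2.stepAux]
    cases f v <;> simp [ih, ih']
  | goto f => rfl
  | halt => rfl
  | _ => simp_all [mapLabel, TM2.stepAux]

/-- A program fragment with a finite set of labels, an entry and two exits. -/
structure Fragment where
  Label : Type
  [fintypeLabel : Fintype Label]
  entry : Label
  code : Label → TM2.Stmt Alphabet (Label ⊕ Bool) Register

namespace Fragment

instance (F : Fragment) : Fintype F.Label := F.fintypeLabel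

/-- From the configuration `c`, the fragment reaches the exit `b` with empty register and
memory `S` in `n` steps. -/
inductive Run (F : Fragment) :
    TM2.Cfg Alphabet (F.Label ⊕ Bool) Register → Bool → Memory → ℕ → Prop
  | exit (b : Bool) (S : Memory) : Run F ⟨some (.inr b), none, S⟩ b S 0
  | step {l : F.Label} {v : Register} {S S' : Memory} {b : Bool} {n : ℕ} :
      Run F (TM2.stepAux (F.code l) v S) b S' n → Run F ⟨some (.inl l), v, S⟩ b S' (n + 1)

/-- The configuration at the entry of the fragment. -/
def start (F : Fragment) (S : Memory) : TM2.Cfg Alphabet (F.Label ⊕ Bool) Register :=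
  ⟨some (.inl F.entry), none, S⟩

/-- A single statement. -/
def block (q : TM2.Stmt Alphabet Bool Register) : Fragment where
  Label := Unit
  entry := ()
  code _ := mapLabel .inr q

/-- Run `F` and then, depending on its exit, `G true` or `G false`. -/
def bind (F : Fragment) (G : Bool → Fragment) : Fragment where
  Label := F.Label ⊕ (Σ b, (G b).Label)
  entry := .inl F.entry
  code
    | .inl l => mapLabel (Sum.elim (fun l => .inl (.inl l))
        fun b => .inl (.inr ⟨b, (G b).entry⟩)) (F.code l)
    | .inr ⟨b, l⟩ => mapLabel (Sum.map (fun l => .inr ⟨b, l⟩) id) ((G b).code l)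

/-- Run `F` again and again until it takes the exit `false`. -/
def loop (F : Fragment) : Fragment where
  Label := F.Label
  entry := F.entry
  code l := mapLabel (Sum.elim .inl fun b => bif b then .inl F.entry else .inr false) (F.code l)

/-- Run `F` and then `G`. -/
def seq (F G : Fragment) : Fragment := F.bind fun _ => G

theorem run_block {q : TM2.Stmt Alphabet Bool Register} {S S' : Memory} {b : Bool}
    (h : TM2.stepAux q none S = ⟨some b, none, S'⟩) : (block q).Run ((block q).start S) b S' 1 := by
  refine .step ?_
  simp only [block, stepAux_mapLabel, h, mapCfg, Option.map_some]
  exact .exit b S'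

theorem Run.bind_right {F : Fragment} {G : Bool → Fragment} {b b' : Bool} {S : Memory} {n : ℕ}
    {c : TM2.Cfg Alphabet ((G b).Label ⊕ Bool) Register} (h : (G b).Run c b' S n) :
    (F.bind G).Run (mapCfg (Sum.map (fun l => .inr ⟨b, l⟩) id) c) b' S n := by
  induction h with
  | exit b S => exact .exit b S
  | step _ ih =>
    refine .step ?_
    simpa only [bind, stepAux_mapLabel] using ih

/-- When `F` exits, its exit label is already renamed to the entry of `G b`, so the transition costs
no step. -/
theorem Run.bind_left {F : Fragment} {G : Bool → Fragment} {b b' : Bool} {S S' : Memory}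
    {m n : ℕ} {c : TM2.Cfg Alphabet (F.Label ⊕ Bool) Register} (h : F.Run c b S m)
    (h' : (G b).Run ((G b).start S) b' S' n) :
    (F.bind G).Run (mapCfg (Sum.elim (fun l => .inl (.inl l))
        fun b => .inl (.inr ⟨b, (G b).entry⟩)) c) b' S' (n + m) := by
  induction h with
  | exit b S => exact h'.bind_right
  | step _ ih =>
    refine .step (n := _ + _) ?_
    simpa only [bind, stepAux_mapLabel] using ih h'

theorem Run.bind {F : Fragment} {G : Bool → Fragment} {b b' : Bool} {S S' S'' : Memory} {m n : ℕ}
    (h : F.Run (F.start S) b S' m) (h' : (G b).Run ((G b).start S') b' S'' n) :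
    (F.bind G).Run ((F.bind G).start S) b' S'' (n + m) :=
  h.bind_left h'

/-- The exit is a variable with an equation because the induction on the run needs a general index.
-/
theorem Run.loop_false {F : Fragment} {S : Memory} {m : ℕ} {b : Bool}
    {c : TM2.Cfg Alphabet (F.Label ⊕ Bool) Register} (h : F.Run c b S m) (hb : b = false) :
    F.loop.Run (mapCfg (Sum.elim .inl fun b => bif b then .inl F.entry else .inr false) c)
      false S m := by
  induction h with
  | exit b S => subst hb; exact .exit false S
  | step _ ih =>
    refine .step ?_
    simpa only [loop, stepAux_mapLabel] using ih hb

theorem Run.loop_true {F : Fragment} {S S' : Memory} {m n : ℕ} {b b' : Bool}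
    {c : TM2.Cfg Alphabet (F.Label ⊕ Bool) Register} (h : F.Run c b S m) (hb : b = true)
    (h' : F.loop.Run (F.loop.start S) b' S' n) :
    F.loop.Run (mapCfg (Sum.elim .inl fun b => bif b then .inl F.entry else .inr false) c)
      b' S' (n + m) := by
  induction h with
  | exit b S => subst hb; exact h'
  | step _ ih =>
    refine .step (n := _ + _) ?_
    simpa only [loop, stepAux_mapLabel] using ih hb h'

/-- `F` takes the memory `S` to `S'` and leaves through the exit `b` after at most `n` steps. -/
def Exec (F : Fragment) (S : Memory) (b : Bool) (S' : Memory) (n : ℕ) : Prop :=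
  ∃ m ≤ n, F.Run (F.start S) b S' m

theorem Exec.mono {F : Fragment} {S S' : Memory} {b : Bool} {m n : ℕ} (h : F.Exec S b S' m)
    (hmn : m ≤ n) : F.Exec S b S' n :=
  h.imp fun _ hk => ⟨hk.1.trans hmn, hk.2⟩

theorem exec_block {q : TM2.Stmt Alphabet Bool Register} {S S' : Memory} {b : Bool}
    (h : TM2.stepAux q none S = ⟨some b, none, S'⟩) : (block q).Exec S b S' 1 :=
  ⟨1, le_rfl, run_block h⟩

theorem Exec.bind {F : Fragment} {G : Bool → Fragment} {b b' : Bool} {S S' S'' : Memory}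
    {m n : ℕ} (h : F.Exec S b S' m) (h' : (G b).Exec S' b' S'' n) :
    (F.bind G).Exec S b' S'' (m + n) := by
  obtain ⟨k, hk, h⟩ := h
  obtain ⟨k', hk', h'⟩ := h'
  exact ⟨k' + k, by omega, h.bind h'⟩

theorem Exec.seq {F G : Fragment} {b b' : Bool} {S S' S'' : Memory} {m n : ℕ}
    (h : F.Exec S b S' m) (h' : G.Exec S' b' S'' n) : (F.seq G).Exec S b' S'' (m + n) :=
  h.bind (G := fun _ => G) h'

theorem Exec.loop_false {F : Fragment} {S S' : Memory} {m : ℕ} (h : F.Exec S false S' m) :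
    F.loop.Exec S false S' m := by
  obtain ⟨k, hk, h⟩ := h
  exact ⟨k, hk, h.loop_false rfl⟩

theorem Exec.loop_true {F : Fragment} {S S' S'' : Memory} {m n : ℕ} {b : Bool}
    (h : F.Exec S true S' m) (h' : F.loop.Exec S' b S'' n) : F.loop.Exec S b S'' (m + n) := by
  obtain ⟨k, hk, h⟩ := h
  obtain ⟨k', hk', h'⟩ := h'
  exact ⟨k' + k, by omega, h.loop_true rfl h'⟩

end Fragment

/-! ### Binary trees on the main stack -/

/-- Binary trees, the data on which the programs operate. -/
inductive BinTree
  | leaf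
  | node (a b : BinTree)

/-- The prefix notation of a tree. -/
def BinTree.flat : BinTree → List Bool
  | leaf => [false]
  | node a b => true :: (a.flat ++ b.flat)

namespace Fragment
open TM2.Stmt

/-- Store a bit that was read in the register. -/
def readBit (_ : Register) (b : Option Bool) : Register := b.map .inr

/-- The bit in the register. -/
def bit : Register → Bool
  | some (.inr b) => b
  | _ => false

/-- One step of moving the topmost tree of the main stack. -/
def moveStep (toLeft toRight : Bool) : Fragment := block <|
  pop .main readBit <|
  (if toLeft then push .left bit else id) <|
  (if toRight then push .right bit else id) <|
  branch bit (push .count bit <| load (fun _ => none) <| goto fun _ => true) <|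
  pop .count readBit <|
  branch bit (load (fun _ => none) <| goto fun _ => true) <|
  load (fun _ => none) <| goto fun _ => false

/-- Remove the topmost tree of the main stack, pushing its symbols on the stacks indicated. -/
def move (toLeft toRight : Bool) : Fragment := (moveStep toLeft toRight).loop

variable (p q : Bool)

theorem exec_moveStep_node {m l r c : List Bool} :
    (moveStep p q).Exec (memory [] (true :: m) l r c) true
      (memory [] m (if p then true :: l else l) (if q then true :: r else r) (true :: c)) 1 := by
  apply exec_block
  cases p <;> cases q <;> simp [readBit, bit]

theorem exec_moveStep_leaf_cons {m l r c : List Bool} :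
    (moveStep p q).Exec (memory [] (false :: m) l r (true :: c)) true
      (memory [] m (if p then false :: l else l) (if q then false :: r else r) c) 1 := by
  apply exec_block
  cases p <;> cases q <;> simp [readBit, bit]

theorem exec_moveStep_leaf_nil {m l r : List Bool} :
    (moveStep p q).Exec (memory [] (false :: m) l r []) false
      (memory [] m (if p then false :: l else l) (if q then false :: r else r) []) 1 := by
  apply exec_block
  cases p <;> cases q <;> simp [readBit, bit]

/-- The marks on the counter stand for the trees that remain to be read after the current one: a
node adds a mark for its second subtree, a leaf consumes one. With a mark present the loop does not
stop after `t` but goes on with one mark less; `h` describes this continuation. -/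
theorem exec_move_cons (t : BinTree) {m l r c : List Bool} {S : Memory} {b : Bool} {n : ℕ}
    (h : (move p q).Exec (memory [] m (if p then t.flat.reverse ++ l else l)
      (if q then t.flat.reverse ++ r else r) c) b S n) :
    (move p q).Exec (memory [] (t.flat ++ m) l r (true :: c)) b S (t.flat.length + n) := by
  induction t generalizing m l r c n with
  | leaf =>
    refine (exec_moveStep_leaf_cons p q).loop_true ?_
    simpa [BinTree.flat, move] using h
  | node t u iht ihu =>
    refine ((exec_moveStep_node p q).loop_true (n := t.flat.length + (u.flat.length + n)) ?_).mono
      (by simp [BinTree.flat]; omega)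
    change (move p q).Exec (memory [] ((t.flat ++ u.flat) ++ m) _ _ _) _ _ _
    rw [List.append_assoc]
    refine iht (ihu ?_)
    convert h using 2 <;> split_ifs <;> simp [BinTree.flat]

theorem exec_move (t : BinTree) {m l r : List Bool} :
    (move p q).Exec (memory [] (t.flat ++ m) l r []) false
      (memory [] m (if p then t.flat.reverse ++ l else l)
      (if q then t.flat.reverse ++ r else r) []) t.flat.length := by
  induction t generalizing m l r with
  | leaf => exact (exec_moveStep_leaf_nil p q).loop_false
  | node t u iht ihu =>
    refine ((exec_moveStep_node p q).loop_true (n := t.flat.length + u.flat.length) ?_).mono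
      (by simp [BinTree.flat]; omega)
    change (move p q).Exec (memory [] ((t.flat ++ u.flat) ++ m) _ _ _) _ _ _
    rw [List.append_assoc]
    refine exec_move_cons p q t ?_
    convert ihu (m := m) using 2 <;> split_ifs <;> simp [BinTree.flat]

/-- Pour the left auxiliary stack back on the main stack. -/
def pourLeft : Fragment := loop <| block <|
  pop .left readBit <|
  branch Option.isSome (push .main bit <| load (fun _ => none) <| goto fun _ => true) <|
  goto fun _ => false

/-- Pour the right auxiliary stack back on the main stack. -/
def pourRight : Fragment := loop <| block <|
  pop .right readBit <|
  branch Option.isSome (push .main bit <| load (fun _ => none) <| goto fun _ => true) <|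
  goto fun _ => false

/-- `move` has reversed the tree on the auxiliary stack, and pouring reverses it again. The
additional step finds the stack empty. -/
theorem exec_pourLeft (m l r : List Bool) :
    pourLeft.Exec (memory [] m l r []) false (memory [] (l.reverse ++ m) [] r [])
      (l.length + 1) := by
  induction l generalizing m with
  | nil => exact (exec_block (by simp [readBit])).loop_false
  | cons b l ih =>
    rw [List.reverse_cons, List.append_assoc, List.length_cons, Nat.add_comm]
    exact Exec.loop_true (exec_block (S' := memory [] (b :: m) l r []) (by simp [readBit, bit])) (ih (b :: m))

theorem exec_pourRight (m l r : List Bool) :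
    pourRight.Exec (memory [] m l r []) false (memory [] (r.reverse ++ m) l [] [])
      (r.length + 1) := by
  induction r generalizing m with
  | nil => exact (exec_block (by simp [readBit])).loop_false
  | cons b l ih =>
    rw [List.reverse_cons, List.append_assoc, List.length_cons, Nat.add_comm]
    exact Exec.loop_true (exec_block (S' := memory [] (b :: m) _ l []) (by simp [readBit, bit])) (ih (b :: m))

/-- The memory in which all stacks but the main stack are empty. -/
abbrev onMain (m : List Bool) : Memory := memory [] m [] [] []

/-- Duplicate the topmost tree. -/
def dup : Fragment := (move true true).seq (pourLeft.seq pourRight)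

/-- Exchange the two topmost trees. -/
def swap : Fragment :=
  (move true false).seq ((move false true).seq (pourLeft.seq pourRight))

/-- Remove the topmost tree. -/
def drop : Fragment := move false false

/-- Push a list of bits, the last one first. -/
def pushStmt : List Bool → TM2.Stmt Alphabet Bool Register → TM2.Stmt Alphabet Bool Register
  | [], q => q
  | b :: w, q => pushStmt w (push .main (fun _ => b) q)

theorem stepAux_pushStmt (w : List Bool) (q : TM2.Stmt Alphabet Bool Register) (v : Register)
    (i : List InputSymbol) (m l r c : List Bool) :
    TM2.stepAux (pushStmt w q) v (memory i m l r c) =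
      TM2.stepAux q v (memory i (w ++ m) l r c) := by
  induction w generalizing q with
  | nil => rfl
  | cons b w ih => simp [pushStmt, ih]

/-- Push a list of bits. -/
def pushBits (w : List Bool) : Fragment := block <| pushStmt w <| goto fun _ => false

/-- Remove the topmost symbol and branch on it. -/
def popBit : Fragment := block <|
  pop .main readBit <|
  branch bit (load (fun _ => none) <| goto fun _ => true)
  (load (fun _ => none) <| goto fun _ => false)

/-- Branch on the topmost symbol. -/
def peekBit : Fragment := block <|
  peek .main readBit <|
  branch bit (load (fun _ => none) <| goto fun _ => true)
  (load (fun _ => none) <| goto fun _ => false)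

theorem exec_dup (t : BinTree) (m : List Bool) :
    dup.Exec (onMain (t.flat ++ m)) false (onMain (t.flat ++ (t.flat ++ m)))
      (3 * t.flat.length + 2) := by
  have h := (exec_move true true t (m := m) (l := []) (r := [])).seq
    ((exec_pourLeft _ _ _).seq (exec_pourRight _ _ _))
  simp only [if_true, List.append_nil, List.reverse_reverse, List.length_reverse] at h
  exact h.mono (by omega)

/-- The first tree waits on the left stack and the second on the right one; as the left stack is
poured back first, the second tree ends on top. -/
theorem exec_swap (t u : BinTree) (m : List Bool) :
    swap.Exec (onMain (t.flat ++ (u.flat ++ m))) false (onMain (u.flat ++ (t.flat ++ m)))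
      (2 * t.flat.length + 2 * u.flat.length + 2) := by
  have h := (exec_move true false t (m := u.flat ++ m) (l := []) (r := [])).seq
    ((exec_move false true u).seq ((exec_pourLeft _ _ _).seq (exec_pourRight _ _ _)))
  simp only [if_true, List.append_nil, List.reverse_reverse, List.length_reverse,
    Bool.false_eq_true, if_false] at h
  exact h.mono (by omega)

theorem exec_drop (t : BinTree) (m : List Bool) :
    drop.Exec (onMain (t.flat ++ m)) false (onMain m) t.flat.length := by
  exact exec_move false false t (m := m) (l := []) (r := [])

theorem exec_pushBits (w m : List Bool) :
    (pushBits w).Exec (onMain m) false (onMain (w ++ m)) 1 :=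
  exec_block (by simp [stepAux_pushStmt])

theorem exec_popBit (b : Bool) (m : List Bool) :
    popBit.Exec (onMain (b :: m)) b (onMain m) 1 :=
  exec_block (by cases b <;> simp [readBit, bit])

theorem exec_peekBit (b : Bool) (m : List Bool) :
    peekBit.Exec (onMain (b :: m)) b (onMain (b :: m)) 1 :=
  exec_block (by cases b <;> simp [readBit, bit])

end Fragment

/-! ### Polynomial bounds -/

theorem Polynomial.eval_nat_mono (p : Polynomial ℕ) : Monotone fun n => p.eval n := by
  intro m n h
  simp only [Polynomial.eval_eq_sum, Polynomial.sum]
  gcongr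

/-- `f` is bounded by a polynomial in `g`. -/
def PolyBounded {ι : Type*} (f g : ι → ℕ) : Prop :=
  ∃ p : Polynomial ℕ, ∀ i, f i ≤ p.eval (g i)

namespace PolyBounded
variable {ι κ : Type*} {f f' g h : ι → ℕ}

theorem of_le (h : ∀ i, f i ≤ g i) : PolyBounded f g := ⟨.X, by simpa using h⟩

theorem refl (f : ι → ℕ) : PolyBounded f f := of_le fun _ => le_rfl

theorem const (c : ℕ) (g : ι → ℕ) : PolyBounded (fun _ => c) g := ⟨.C c, by simp⟩

theorem add (hf : PolyBounded f g) (hf' : PolyBounded f' g) :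
    PolyBounded (fun i => f i + f' i) g := by
  obtain ⟨p, hp⟩ := hf
  obtain ⟨q, hq⟩ := hf'
  exact ⟨p + q, fun i => by simpa using Nat.add_le_add (hp i) (hq i)⟩

theorem mul (hf : PolyBounded f g) (hf' : PolyBounded f' g) :
    PolyBounded (fun i => f i * f' i) g := by
  obtain ⟨p, hp⟩ := hf
  obtain ⟨q, hq⟩ := hf'
  exact ⟨p * q, fun i => by simpa using Nat.mul_le_mul (hp i) (hq i)⟩

theorem trans (hf : PolyBounded f g) (hg : PolyBounded g h) : PolyBounded f h := by
  obtain ⟨p, hp⟩ := hf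
  obtain ⟨q, hq⟩ := hg
  exact ⟨p.comp q, fun i => by
    rw [Polynomial.eval_comp]; exact (hp i).trans (p.eval_nat_mono (hq i))⟩

theorem mono (hf : PolyBounded f g) (h : ∀ i, f' i ≤ f i) : PolyBounded f' g :=
  hf.imp fun _ hp i => (h i).trans (hp i)

theorem subst (hf : PolyBounded f g) (u : κ → ι) :
    PolyBounded (fun k => f (u k)) (fun k => g (u k)) :=
  hf.imp fun _ hp k => hp (u k)

end PolyBounded

/-! ### Polynomial time on coded data -/

/-- Types whose elements are coded by binary trees. -/
class Coded (α : Type*) where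
  code : α → BinTree

/-- The word that codes an element. -/
def bits {α : Type*} [Coded α] (a : α) : List Bool := (Coded.code a).flat

/-- The length of the code of an element. -/
def size {α : Type*} [Coded α] (a : α) : ℕ := (bits a).length

instance : Coded BinTree := ⟨id⟩
instance : Coded Unit := ⟨fun _ => .leaf⟩
instance : Coded Bool := ⟨fun b => bif b then .node .leaf .leaf else .leaf⟩
instance {α β : Type*} [Coded α] [Coded β] : Coded (α × β) :=
  ⟨fun p => .node (Coded.code p.1) (Coded.code p.2)⟩
instance {α : Type*} [Coded α] : Coded (Option α) :=
  ⟨fun o => o.elim .leaf fun a => .node .leaf (Coded.code a)⟩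

/-- The code of a list. -/
def codeList {α : Type*} [Coded α] : List α → BinTree
  | [] => .leaf
  | a :: l => .node (Coded.code a) (codeList l)

instance {α : Type*} [Coded α] : Coded (List α) := ⟨codeList⟩

section size
variable {α β : Type*} [Coded α] [Coded β]

theorem size_pos (a : α) : 0 < size a := by
  unfold size bits
  cases Coded.code a <;> simp [BinTree.flat]

theorem bits_pair (p : α × β) : bits p = true :: (bits p.1 ++ bits p.2) := rfl

theorem size_pair (p : α × β) : size p = 1 + size p.1 + size p.2 := by
  simp [size, bits, Coded.code, BinTree.flat]; omega

@[simp] theorem size_nil : size ([] : List α) = 1 := rfl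

@[simp] theorem size_cons (a : α) (l : List α) : size (a :: l) = 1 + size a + size l := by
  simp [size, bits, Coded.code, BinTree.flat, codeList]; omega

theorem size_bool_le (b : Bool) : size b ≤ 3 := by
  cases b <;> simp [size, bits, Coded.code, BinTree.flat]

@[simp] theorem size_none : size (none : Option α) = 1 := rfl

@[simp] theorem size_some (a : α) : size (some a) = 2 + size a := by
  simp [size, bits, Coded.code, BinTree.flat]; omega

theorem length_le_size (l : List α) : l.length ≤ size l := by
  induction l with
  | nil => simp
  | cons a l ih => simp; omega

theorem size_le_of_mem {a : α} {l : List α} (h : a ∈ l) : size a ≤ size l := by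
  induction l with
  | nil => simp at h
  | cons b l ih =>
    rcases List.mem_cons.1 h with rfl | h
    · simp; omega
    · have := ih h; simp; omega

end size

namespace Fragment

/-- Leave through the given exit. -/
def exit (b : Bool) : Fragment := block <| .goto fun _ => b

theorem exec_exit (b : Bool) (S : Memory) : (exit b).Exec S b S 1 := exec_block (by simp)

/-- Remove a truth value and branch on it. -/
def popBool : Fragment :=
  popBit.bind fun b => bif b then (drop.seq drop).seq (exit true) else exit false

theorem exec_popBool (b : Bool) (m : List Bool) :
    popBool.Exec (onMain (bits b ++ m)) b (onMain m) 4 := by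
  cases b
  · exact ((exec_popBit false m).bind (G := fun b => bif b then _ else _)
      (exec_exit false _)).mono (by simp)
  · exact ((exec_popBit true _).bind (G := fun b => bif b then _ else _)
      (((exec_drop .leaf _).seq (exec_drop .leaf m)).seq (exec_exit true _))).mono
      (by simp [BinTree.flat])

end Fragment

open Fragment in
/-- `y i` is computable in polynomial time from `x i`, uniformly in `i`. -/
def PolyTime {ι α β : Type*} [Coded α] [Coded β] (x : ι → α) (y : ι → β) : Prop :=
  ∃ (F : Fragment) (t : ι → ℕ), PolyBounded t (fun i => size (x i)) ∧
    PolyBounded (fun i => size (y i)) (fun i => size (x i)) ∧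
    ∀ i m, F.Exec (onMain (bits (x i) ++ m)) false (onMain (bits (y i) ++ m)) (t i)

/-! ### Closure properties of polynomial-time computability -/

namespace PolyTime
open Fragment
variable {ι κ α β γ δ : Type*} [Coded α] [Coded β] [Coded γ] [Coded δ]
  {x : ι → α} {y : ι → β} {z : ι → γ}

theorem size_bounded (h : PolyTime x y) :
    PolyBounded (fun i => size (y i)) (fun i => size (x i)) := by
  obtain ⟨_, _, _, h, _⟩ := h
  exact h

theorem refl (x : ι → α) : PolyTime x x :=
  ⟨exit false, fun _ => 1, .const _ _, .refl _, fun _ _ => exec_exit false _⟩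

/-- Programs see only the tree codes, so data of different types with the same code are
interchangeable; constructors of options and lists are thereby reduced to pairs. -/
theorem congr (h : PolyTime x y) {y' : ι → δ} (hy : ∀ i, Coded.code (y' i) = Coded.code (y i)) :
    PolyTime x y' := by
  have hb : ∀ i, bits (y' i) = bits (y i) := fun i => by rw [bits, bits, hy]
  obtain ⟨F, t, ht, hs, hF⟩ := h
  exact ⟨F, t, ht, by simpa only [size, hb] using hs, by simpa only [hb] using hF⟩

theorem congr_left (h : PolyTime x y) {x' : ι → δ}
    (hx : ∀ i, Coded.code (x' i) = Coded.code (x i)) : PolyTime x' y := by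
  have hb : ∀ i, bits (x' i) = bits (x i) := fun i => by rw [bits, bits, hx]
  obtain ⟨F, t, ht, hs, hF⟩ := h
  exact ⟨F, t, by simpa only [size, hb] using ht, by simpa only [size, hb] using hs,
    by simpa only [hb] using hF⟩

theorem subst (h : PolyTime x y) (u : κ → ι) :
    PolyTime (fun k => x (u k)) (fun k => y (u k)) := by
  obtain ⟨F, t, ht, hs, hF⟩ := h
  exact ⟨F, fun k => t (u k), ht.subst u, hs.subst u, fun k m => hF (u k) m⟩

/-- The second program runs in time polynomial in the intermediate result; this is why `PolyTime`
also bounds the size of the output. -/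
theorem trans (h : PolyTime x y) (h' : PolyTime y z) : PolyTime x z := by
  obtain ⟨F, t, ht, hs, hF⟩ := h
  obtain ⟨G, u, hu, hs', hG⟩ := h'
  exact ⟨F.seq G, fun i => t i + u i, ht.add (hu.trans hs), hs'.trans hs,
    fun i m => (hF i m).seq (hG i m)⟩

theorem app {f : β → γ} (hf : PolyTime (fun b => b) f) (hy : PolyTime x y) :
    PolyTime x fun i => f (y i) :=
  hy.trans (hf.subst y)

theorem const (x : ι → α) (b : β) : PolyTime x fun _ => b := by
  refine ⟨drop.seq (pushBits (bits b)), fun i => size (x i) + 1,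
    (PolyBounded.refl _).add (.const _ _), .const _ _, fun i m => ?_⟩
  exact (exec_drop (Coded.code (x i)) m).seq (exec_pushBits _ m)

/-- Compute `z` on a copy of the input, exchange it with the original, and compute `y` there. The
final symbol `true` joins both results to a node. -/
theorem pair (hy : PolyTime x y) (hz : PolyTime x z) : PolyTime x fun i => (y i, z i) := by
  obtain ⟨F, t, ht, hs, hF⟩ := hz
  obtain ⟨G, u, hu, hs', hG⟩ := hy
  refine ⟨dup.seq (F.seq (swap.seq (G.seq (pushBits [true])))), fun i =>
      (3 * size (x i) + 2) + (t i + ((2 * size (z i) + 2 * size (x i) + 2) + (u i + 1))),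
    ?_, ?_, fun i m => ?_⟩
  · have h1 := PolyBounded.refl fun i => size (x i)
    have h2 : ∀ c, PolyBounded (fun _ => c) fun i => size (x i) := fun c => .const c _
    exact (((h2 3).mul h1).add (h2 2)).add (ht.add
      (((((h2 2).mul hs).add ((h2 2).mul h1)).add (h2 2)).add (hu.add (h2 1))))
  · simp only [size_pair]
    exact ((PolyBounded.const 1 _).add hs').add hs
  · have h := (exec_dup (Coded.code (x i)) m).seq ((hF i _).seq ((exec_swap (Coded.code (z i))
      (Coded.code (x i)) m).seq ((hG i _).seq (exec_pushBits [true] _))))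
    rw [bits_pair, List.cons_append, List.append_assoc]
    exact h

theorem fst {y : ι → β × γ} (hy : PolyTime x y) : PolyTime x fun i => (y i).1 := by
  refine hy.trans ⟨popBit.bind fun _ => swap.seq drop, fun i =>
    1 + ((2 * size (y i).1 + 2 * size (y i).2 + 2) + size (y i).2),
    ?_, .of_le fun i => by simp only [size_pair]; omega, fun i m => ?_⟩
  · refine (((PolyBounded.const 5 _).mul (.refl _)).add (.const 3 _)).mono
      (f := fun i => 5 * size (y i) + 3) fun i => ?_
    rw [size_pair]; omega
  · have h := (exec_popBit true (bits (y i).1 ++ (bits (y i).2 ++ m))).bind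
      (G := fun _ => swap.seq drop) ((exec_swap _ _ m).seq (exec_drop _ _))
    rw [bits_pair, List.cons_append, List.append_assoc]
    exact h

theorem snd {y : ι → β × γ} (hy : PolyTime x y) : PolyTime x fun i => (y i).2 := by
  refine hy.trans ⟨popBit.bind fun _ => drop, fun i => 1 + size (y i).1,
    .of_le fun i => by simp only [size_pair]; omega,
    .of_le fun i => by simp only [size_pair]; omega,
    fun i m => ?_⟩
  have h := (exec_popBit true (bits (y i).1 ++ (bits (y i).2 ++ m))).bind
    (G := fun _ => drop) (exec_drop _ _)
  rw [bits_pair, List.cons_append, List.append_assoc]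
  exact h

/-- Whether a tree is a node. -/
def _root_.BinTree.isNode : BinTree → Bool
  | .leaf => false
  | .node _ _ => true

theorem isNode (hy : PolyTime x y) : PolyTime x fun i => (Coded.code (y i)).isNode := by
  refine hy.trans ⟨peekBit.bind fun b => drop.seq (pushBits (bits b)), fun i =>
    1 + (size (y i) + 1), (PolyBounded.const 1 _).add ((PolyBounded.refl _).add (.const 1 _)),
    (PolyBounded.const 3 _).mono fun i => size_bool_le _, fun i m => ?_⟩
  obtain ⟨b, w, h, hb⟩ : ∃ b w, bits (y i) = b :: w ∧ (Coded.code (y i)).isNode = b := by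
    unfold bits
    cases Coded.code (y i) <;> simp [BinTree.flat, BinTree.isNode]
  have h1 := exec_peekBit b (w ++ m)
  rw [← List.cons_append, ← h] at h1
  simp only [hb]
  exact h1.bind (G := fun b => drop.seq (pushBits (bits b)))
    ((exec_drop (Coded.code (y i)) m).seq (exec_pushBits _ _))

/-- Evaluate a condition without losing the data. -/
theorem exists_test {c : ι → Bool} (hc : PolyTime x c) : ∃ (F : Fragment) (t : ι → ℕ),
    PolyBounded t (fun i => size (x i)) ∧
    ∀ i m, F.Exec (onMain (bits (x i) ++ m)) (c i) (onMain (bits (x i) ++ m)) (t i) := by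
  obtain ⟨F, t, ht, hs, hF⟩ := hc
  refine ⟨dup.seq (F.seq popBool), fun i => (3 * size (x i) + 2) + (t i + 4),
    (((PolyBounded.const 3 _).mul (.refl _)).add (.const 2 _)).add (ht.add (.const 4 _)),
    fun i m => ?_⟩
  exact (exec_dup (Coded.code (x i)) m).seq ((hF i _).seq (exec_popBool _ _))

/-- Each branch is a family over a subtype, so it may rely on its condition. The time functions of
the branches exist only on the subtypes; the total bound therefore uses the polynomials that
dominate them. -/
theorem ite' {c : ι → Bool} (hc : PolyTime x c)
    (ht : PolyTime (fun i : {i // c i = true} => x i) fun i => y i)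
    (hf : PolyTime (fun i : {i // c i = false} => x i) fun i => y i) : PolyTime x y := by
  obtain ⟨C, tc, htc, hC⟩ := exists_test hc
  obtain ⟨F, t, ⟨p, hp⟩, ⟨p', hp'⟩, hF⟩ := ht
  obtain ⟨G, u, ⟨q, hq⟩, ⟨q', hq'⟩, hG⟩ := hf
  refine ⟨C.bind fun b => bif b then F else G, fun i =>
    tc i + (p.eval (size (x i)) + q.eval (size (x i))),
    htc.add (.add ⟨p, fun _ => le_rfl⟩ ⟨q, fun _ => le_rfl⟩),
    ⟨p' + q', fun i => ?_⟩, fun i m => ?_⟩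
  · rw [Polynomial.eval_add]
    cases h : c i
    · exact (hq' ⟨i, h⟩).trans (Nat.le_add_left _ _)
    · exact (hp' ⟨i, h⟩).trans (Nat.le_add_right _ _)
  · refine (hC i m).bind ?_
    cases h : c i
    · exact (hG ⟨i, h⟩ m).mono ((hq ⟨i, h⟩).trans (Nat.le_add_left _ _))
    · exact (hF ⟨i, h⟩ m).mono ((hp ⟨i, h⟩).trans (Nat.le_add_right _ _))

theorem cond {c : ι → Bool} {y' : ι → β} (hc : PolyTime x c) (hy : PolyTime x y)
    (hy' : PolyTime x y') : PolyTime x fun i => bif c i then y i else y' i :=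
  ite' hc ((hy.subst Subtype.val).congr fun i => by simp [i.2])
    ((hy'.subst Subtype.val).congr fun i => by simp [i.2])

/-- Iteration of a polynomial-time step, as long as a condition holds. -/
theorem iterate {σ : Type*} {s : σ → β} {c : σ → Bool} {f : σ → σ} (hc : PolyTime s c)
    (hf : PolyTime s fun a => s (f a)) {a : ι → σ} (ha : PolyTime x fun i => s (a i))
    {n d : ι → ℕ} (hn : PolyBounded n fun i => size (x i))
    (hd : PolyBounded d fun i => size (x i))
    (hsize : ∀ i, ∀ k ≤ n i, size (s (f^[k] (a i))) ≤ d i)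
    (hstep : ∀ i, ∀ k < n i, c (f^[k] (a i)) = true) (hend : ∀ i, c (f^[n i] (a i)) = false) :
    PolyTime x fun i => s (f^[n i] (a i)) := by
  obtain ⟨C, tc, ⟨p, hp⟩, hC⟩ := exists_test hc
  obtain ⟨F, t, ⟨q, hq⟩, -, hF⟩ := hf
  obtain ⟨G, u, hu, hs, hG⟩ := ha
  refine ⟨G.seq (loop (C.bind fun b => bif b then F.seq (exit true) else exit false)), fun i =>
    u i + (n i + 1) * (p.eval (d i) + (q.eval (d i) + 1)), hu.add ((hn.add (.const 1 _)).mul ?_),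
    hd.mono fun i => hsize i _ le_rfl, fun i m => (hG i m).seq ?_⟩
  · exact (PolyBounded.trans ⟨p, fun _ => le_rfl⟩ hd).add
      ((PolyBounded.trans ⟨q, fun _ => le_rfl⟩ hd).add (.const 1 _))
  -- Induction on the number `j` of rounds still to come after `k` rounds. All states have size at
  -- most `d i`, which bounds the cost of a round uniformly; the extra round is the failing test.
  · suffices h : ∀ j k, k + j = n i → Fragment.Exec (loop (C.bind fun b =>
        bif b then F.seq (exit true) else exit false)) (onMain (bits (s (f^[k] (a i))) ++ m)) false
        (onMain (bits (s (f^[n i] (a i))) ++ m))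
        ((j + 1) * (p.eval (d i) + (q.eval (d i) + 1))) from h (n i) 0 (by simp)
    intro j
    induction j with
    | zero =>
      intro k hk
      obtain rfl : k = n i := hk
      have h := hC (f^[n i] (a i)) m
      rw [hend i] at h
      refine (h.bind (G := fun b => bif b then _ else _) (exec_exit false _)).loop_false.mono ?_
      have := (hp (f^[n i] (a i))).trans (p.eval_nat_mono (hsize i _ le_rfl))
      rw [Nat.zero_add, Nat.one_mul]
      exact Nat.add_le_add this (by omega)
    | succ j ih =>
      intro k hk
      have h := hC (f^[k] (a i)) m
      rw [hstep i k (by omega)] at h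
      have h' := hF (f^[k] (a i)) m
      simp only [← Function.iterate_succ_apply' f] at h'
      refine ((h.bind (G := fun b => bif b then _ else _) (h'.seq (exec_exit true _))).loop_true
        (ih (k + 1) (by omega))).mono ?_
      have h1 := (hp (f^[k] (a i))).trans (p.eval_nat_mono (hsize i k (by omega)))
      have h2 := (hq (f^[k] (a i))).trans (q.eval_nat_mono (hsize i k (by omega)))
      have h3 := Nat.add_le_add h1 (Nat.add_le_add_right h2 1)
      rw [Nat.succ_mul (j + 1), Nat.add_comm]
      exact Nat.add_le_add_left h3 _

end PolyTime

namespace PolyTime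
variable {ι κ α β γ δ ε : Type*} [Coded α] [Coded β] [Coded γ] [Coded δ] [Coded ε]
  {x : ι → α}

/-! ### Options and lists -/

/-- Passing from `ι` to `ι × γ` extends a context by a variable of type `γ`. With `var` this allows
bodies of folds and case distinctions to be treated as terms with free variables. -/
theorem weaken {y : ι → β} (h : PolyTime x y) :
    PolyTime (fun p : ι × γ => (x p.1, p.2)) fun p => y p.1 :=
  ((refl fun p : ι × γ => (x p.1, p.2)).fst).trans (h.subst Prod.fst)

theorem var (x : ι → α) : PolyTime (fun p : ι × γ => (x p.1, p.2)) fun p => p.2 :=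
  (refl _).snd

theorem var_fst (x : ι → α) :
    PolyTime (fun p : ι × γ × δ => (x p.1, p.2.1, p.2.2)) fun p => p.2.1 :=
  (refl (fun p : ι × γ × δ => (x p.1, p.2.1, p.2.2))).snd.fst

theorem var_snd (x : ι → α) :
    PolyTime (fun p : ι × γ × δ => (x p.1, p.2.1, p.2.2)) fun p => p.2.2 :=
  (refl (fun p : ι × γ × δ => (x p.1, p.2.1, p.2.2))).snd.snd

/-- The result is specified by equations, so that it may be any function defined by cases. -/
theorem option_cases {o : ι → Option γ} {y n : ι → β} {s : ι → γ → β} (ho : PolyTime x o)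
    (hn : PolyTime x n)
    (hs : PolyTime (fun p : ι × γ => (x p.1, p.2)) fun p => s p.1 p.2)
    (hyn : ∀ i, o i = none → y i = n i) (hys : ∀ i a, o i = some a → y i = s i a) :
    PolyTime x y := by
  refine ((refl x).pair ho).trans (ite' (isNode (refl fun i => (x i, o i)).snd) ?_ ?_)
  · have hsome : ∀ i : {i // (Coded.code (o i)).isNode = true}, (o i).isSome := by
      rintro ⟨i, hi⟩
      cases h : o i <;> simp_all [Coded.code, BinTree.isNode]
    -- `some a` has the same code as the pair `((), a)`, so the content is a second projection.
    have h1 : PolyTime (fun p : ι × γ => (x p.1, ((), p.2))) fun p => s p.1 p.2 :=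
      PolyTime.trans ((refl (fun p : ι × γ => (x p.1, ((), p.2)))).fst.pair
        (refl (fun p : ι × γ => (x p.1, ((), p.2)))).snd.snd) hs
    have h2 := h1.subst fun i : {i // (Coded.code (o i)).isNode = true} =>
      (i.1, (o i).get (hsome i))
    refine (h2.congr_left fun i => ?_).congr fun i => ?_
    · obtain ⟨a, ha⟩ := Option.isSome_iff_exists.1 (hsome i)
      simp [Coded.code, ha]
    · rw [hys i _ (Option.some_get (hsome i)).symm]
  · refine PolyTime.trans (refl (fun i : {i // (Coded.code (o i)).isNode = false} =>
        (x i, o i))).fst ((hn.subst Subtype.val).congr fun i => ?_)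
    obtain ⟨i, hi⟩ := i
    rw [hyn i]
    cases h : o i
    · rfl
    · rw [h] at hi; cases hi

theorem list_cases {l : ι → List γ} {y n : ι → β} {s : ι → γ → List γ → β} (hl : PolyTime x l)
    (hn : PolyTime x n)
    (hs : PolyTime (fun p : ι × γ × List γ => (x p.1, p.2.1, p.2.2)) fun p => s p.1 p.2.1 p.2.2)
    (hyn : ∀ i, l i = [] → y i = n i) (hys : ∀ i a t, l i = a :: t → y i = s i a t) :
    PolyTime x y := by
  refine ((refl x).pair hl).trans (ite' (isNode (refl fun i => (x i, l i)).snd) ?_ ?_)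
  · have hne : ∀ i : {i // (Coded.code (l i)).isNode = true}, l i ≠ [] := by
      rintro ⟨i, hi⟩
      cases h : l i <;> simp_all [Coded.code, codeList, BinTree.isNode]
    have h2 := hs.subst fun i : {i // (Coded.code (l i)).isNode = true} =>
      (i.1, (l i).head (hne i), (l i).tail)
    refine (h2.congr_left fun i => ?_).congr fun i => ?_
    · obtain ⟨a, t, ha⟩ := List.exists_cons_of_ne_nil (hne i)
      simp [Coded.code, codeList, ha]
    · rw [hys i _ _ (List.cons_head_tail (hne i)).symm]
  · refine PolyTime.trans (refl (fun i : {i // (Coded.code (l i)).isNode = false} =>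
        (x i, l i))).fst ((hn.subst Subtype.val).congr fun i => ?_)
    obtain ⟨i, hi⟩ := i
    rw [hyn i]
    cases h : l i
    · rfl
    · rw [h] at hi; cases hi

theorem some {y : ι → β} (hy : PolyTime x y) : PolyTime x fun i => Option.some (y i) :=
  ((const x ()).pair hy).congr fun _ => rfl

theorem cons {y : ι → β} {l : ι → List β} (hy : PolyTime x y) (hl : PolyTime x l) :
    PolyTime x fun i => y i :: l i :=
  (hy.pair hl).congr fun _ => rfl

theorem head? {l : ι → List β} (hl : PolyTime x l) : PolyTime x fun i => (l i).head? :=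
  list_cases (s := fun _ a _ => Option.some a) hl (const x none) (var_fst x).some (fun i h => by simp [h])
    fun i a t h => by simp [h]

theorem tail {l : ι → List β} (hl : PolyTime x l) : PolyTime x fun i => (l i).tail :=
  list_cases (s := fun _ _ t => t) hl (const x []) (var_snd x) (fun i h => by simp [h])
    fun i a t h => by simp [h]

theorem headD {l : ι → List β} {d : ι → β} (hl : PolyTime x l) (hd : PolyTime x d) :
    PolyTime x fun i => (l i).headD (d i) :=
  list_cases (s := fun _ a _ => a) hl hd (var_fst x) (fun i h => by simp [h]) fun i a t h => by simp [h]

theorem isEmpty {l : ι → List β} (hl : PolyTime x l) : PolyTime x fun i => (l i).isEmpty :=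
  list_cases (s := fun _ _ _ => false) hl (const x true) (const _ false) (fun i h => by simp [h])
    fun i a t h => by simp [h]

theorem bool_fun (f : Bool → β) {b : ι → Bool} (hb : PolyTime x b) :
    PolyTime x fun i => f (b i) :=
  (cond hb (const x (f true)) (const x (f false))).congr fun i => by cases b i <;> rfl

theorem bool_fun₂ (f : Bool → Bool → β) {b c : ι → Bool} (hb : PolyTime x b)
    (hc : PolyTime x c) : PolyTime x fun i => f (b i) (c i) :=
  (cond hb (bool_fun (f true) hc) (bool_fun (f false) hc)).congr fun i => by cases b i <;> rfl

theorem bool_fun₃ (f : Bool → Bool → Bool → β) {b c d : ι → Bool} (hb : PolyTime x b)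
    (hc : PolyTime x c) (hd : PolyTime x d) : PolyTime x fun i => f (b i) (c i) (d i) :=
  (cond hb (bool_fun₂ (f true) hc hd) (bool_fun₂ (f false) hc hd)).congr fun i => by
    cases b i <;> rfl

theorem and {b c : ι → Bool} (hb : PolyTime x b) (hc : PolyTime x c) :
    PolyTime x fun i => b i && c i := bool_fun₂ (· && ·) hb hc

theorem or {b c : ι → Bool} (hb : PolyTime x b) (hc : PolyTime x c) :
    PolyTime x fun i => b i || c i := bool_fun₂ (· || ·) hb hc

theorem not {b : ι → Bool} (hb : PolyTime x b) : PolyTime x fun i => !(b i) := bool_fun (!·) hb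

/-- One step of a left fold. -/
def foldlStep (s : ι → β → γ → β) (p : ι × β × List γ) : ι × β × List γ :=
  match p.2.2 with
  | [] => p
  | a :: t => (p.1, s p.1 p.2.1 a, t)

omit [Coded β] [Coded γ] in
theorem iterate_foldlStep (s : ι → β → γ → β) (i : ι) (b : β) (l : List γ) (k : ℕ) :
    (foldlStep s)^[k] (i, b, l) = (i, (l.take k).foldl (s i) b, l.drop k) := by
  induction k generalizing b l with
  | zero => simp
  | succ k ih =>
    cases l with
    | nil => simpa [foldlStep] using ih b []
    | cons a t => simpa [foldlStep] using ih (s i b a) t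

theorem size_drop_le (l : List γ) (k : ℕ) : size (l.drop k) ≤ size l := by
  induction l generalizing k with
  | nil => simp
  | cons a l ih => cases k with
    | zero => simp
    | succ k => have := ih k; simp; omega

/-- The partial results must be bounded separately: a polynomial-time step such as doubling the
length of the accumulator could otherwise produce exponential growth. The loop state carries `x i`,
on which the step may depend. -/
theorem foldl {l : ι → List γ} {b : ι → β} {s : ι → β → γ → β} (hl : PolyTime x l)
    (hb : PolyTime x b)
    (hs : PolyTime (fun p : ι × β × γ => (x p.1, p.2.1, p.2.2)) fun p => s p.1 p.2.1 p.2.2)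
    {d : ι → ℕ} (hd : PolyBounded d fun i => size (x i))
    (hsize : ∀ i, ∀ k ≤ (l i).length, size (((l i).take k).foldl (s i) (b i)) ≤ d i) :
    PolyTime x fun i => (l i).foldl (s i) (b i) := by
  have hst := refl (fun p : ι × β × List γ => (x p.1, p.2.1, p.2.2))
  have hbase := refl (fun q : (ι × β × List γ) × γ × List γ =>
    ((x q.1.1, q.1.2.1, q.1.2.2), q.2.1, q.2.2))
  have hstep : PolyTime (fun p : ι × β × List γ => (x p.1, p.2.1, p.2.2)) fun p =>
      (x (foldlStep s p).1, (foldlStep s p).2.1, (foldlStep s p).2.2) := by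
    refine list_cases (s := fun p a t => (x p.1, s p.1 p.2.1 a, t)) hst.snd.snd hst
      (hbase.fst.fst.pair (PolyTime.pair ?_ hbase.snd.snd)) ?_ ?_
    · exact (hbase.fst.fst.pair (hbase.fst.snd.fst.pair hbase.snd.fst)).trans
        (hs.subst fun q : (ι × β × List γ) × γ × List γ => (q.1.1, q.1.2.1, q.2.1))
    · rintro ⟨i, b, l⟩ h
      obtain rfl : l = [] := h
      rfl
    · rintro ⟨i, b, l⟩ a t h
      obtain rfl : l = a :: t := h
      rfl
  have h := iterate (x := x) (c := fun p : ι × β × List γ => !p.2.2.isEmpty)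
    (hst.snd.snd.isEmpty.not) hstep (a := fun i => (i, b i, l i)) ((refl x).pair (hb.pair hl))
    (n := fun i => (l i).length) (d := fun i => 1 + size (x i) + (1 + d i + size (l i)))
    (hl.size_bounded.mono fun i => length_le_size _)
    (((PolyBounded.const 1 _).add (.refl _)).add
      (((PolyBounded.const 1 _).add hd).add hl.size_bounded))
    (fun i k hk => by
      simp only [iterate_foldlStep, size_pair]
      have h1 := hsize i k hk
      have h2 := size_drop_le (l i) k
      omega)
    (fun i k hk => by simpa [iterate_foldlStep] using hk)
    (fun i => by simp [iterate_foldlStep])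
  exact h.snd.fst.congr fun i => by simp [iterate_foldlStep]

/-- A left fold in which every step increases a measure of the size by a bounded amount. -/
theorem foldl_of_measure_le {l : ι → List γ} {b : ι → β} {s : ι → β → γ → β}
    (hl : PolyTime x l) (hb : PolyTime x b)
    (hs : PolyTime (fun p : ι × β × γ => (x p.1, p.2.1, p.2.2)) fun p => s p.1 p.2.1 p.2.2)
    (μ : β → ℕ) {k : ℕ} (hμ : ∀ c, size c ≤ k * μ c + k) (hμ' : ∀ c, μ c ≤ size c)
    {d : ι → ℕ} (hd : PolyBounded d fun i => size (x i))
    (hstep : ∀ i c, ∀ a ∈ l i, μ (s i c a) ≤ μ c + d i) :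
    PolyTime x fun i => (l i).foldl (s i) (b i) := by
  refine foldl hl hb hs (d := fun i => k * (size (b i) + size (l i) * d i) + k)
    (((PolyBounded.const k _).mul (hb.size_bounded.add (hl.size_bounded.mul hd))).add
      (.const k _)) fun i j _ => (hμ _).trans ?_
  have key : ∀ t : List γ, (∀ a ∈ t, a ∈ l i) → ∀ c,
      μ (t.foldl (s i) c) ≤ μ c + t.length * d i := by
    intro t
    induction t with
    | nil => simp
    | cons a t ih =>
      intro ht c
      have h1 := ih (fun a ha => ht a (List.mem_cons_of_mem _ ha)) (s i c a)
      have h2 := hstep i c a (ht a List.mem_cons_self)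
      simp only [List.foldl_cons, List.length_cons, Nat.succ_mul]
      omega
  gcongr
  refine (key _ (fun a ha => List.mem_of_mem_take ha) _).trans
    (Nat.add_le_add (hμ' _) (Nat.mul_le_mul_right _ ?_))
  exact (by simp : _ ≤ (l i).length).trans (length_le_size _)

/-- A left fold in which every step increases the size by a bounded amount. -/
theorem foldl_of_size_le {l : ι → List γ} {b : ι → β} {s : ι → β → γ → β} (hl : PolyTime x l)
    (hb : PolyTime x b)
    (hs : PolyTime (fun p : ι × β × γ => (x p.1, p.2.1, p.2.2)) fun p => s p.1 p.2.1 p.2.2)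
    {d : ι → ℕ} (hd : PolyBounded d fun i => size (x i))
    (hsize : ∀ i c, ∀ a ∈ l i, size (s i c a) ≤ size c + d i) :
    PolyTime x fun i => (l i).foldl (s i) (b i) :=
  foldl_of_measure_le hl hb hs size (k := 1) (by simp) (fun _ => le_rfl) hd hsize

theorem reverse {l : ι → List β} (hl : PolyTime x l) : PolyTime x fun i => (l i).reverse := by
  have h := foldl_of_size_le (s := fun _ (t : List β) a => a :: t) hl (const x [])
    ((var_snd x).cons (var_fst x)) (d := fun i => 1 + size (l i))
    ((PolyBounded.const 1 _).add hl.size_bounded) fun i c a ha => by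
      have := size_le_of_mem ha
      simp only [size_cons]; omega
  exact h.congr fun i => by rw [← List.foldr_reverse]; simp

theorem foldr_of_size_le {l : ι → List γ} {b : ι → β} {s : ι → γ → β → β} (hl : PolyTime x l)
    (hb : PolyTime x b)
    (hs : PolyTime (fun p : ι × β × γ => (x p.1, p.2.1, p.2.2)) fun p => s p.1 p.2.2 p.2.1)
    {d : ι → ℕ} (hd : PolyBounded d fun i => size (x i))
    (hsize : ∀ i c, ∀ a ∈ l i, size (s i a c) ≤ size c + d i) :
    PolyTime x fun i => (l i).foldr (s i) (b i) :=
  (foldl_of_size_le (s := fun i c a => s i a c) hl.reverse hb hs hd fun i c a ha =>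
    hsize i c a (List.mem_reverse.1 ha)).congr fun i => by simp

/-- A left fold whose steps have bounded results. -/
theorem foldl_bool {l : ι → List γ} {b : ι → Bool} {s : ι → Bool → γ → Bool} (hl : PolyTime x l)
    (hb : PolyTime x b)
    (hs : PolyTime (fun p : ι × Bool × γ => (x p.1, p.2.1, p.2.2)) fun p => s p.1 p.2.1 p.2.2) :
    PolyTime x fun i => (l i).foldl (s i) (b i) :=
  foldl_of_size_le hl hb hs (d := fun _ => 3) (.const _ _) fun _ _ _ _ =>
    (size_bool_le _).trans (Nat.le_add_left _ _)

theorem all {l : ι → List γ} {f : ι → γ → Bool} (hl : PolyTime x l)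
    (hf : PolyTime (fun p : ι × γ => (x p.1, p.2)) fun p => f p.1 p.2) :
    PolyTime x fun i => (l i).all (f i) := by
  have hbase := refl (fun p : ι × Bool × γ => (x p.1, p.2.1, p.2.2))
  have h := foldl_bool (s := fun i c a => c && f i a) hl (const x true)
    (hbase.snd.fst.and ((hbase.fst.pair hbase.snd.snd).trans
      (hf.subst fun p : ι × Bool × γ => (p.1, p.2.2))))
  refine h.congr fun i => ?_
  have key : ∀ (t : List γ) (c : Bool), t.foldl (fun c a => c && f i a) c = (c && t.all (f i)) := by
    intro t
    induction t with
    | nil => simp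
    | cons a t ih => intro c; simp [ih, Bool.and_assoc]
  simp [key]

theorem any {l : ι → List γ} {f : ι → γ → Bool} (hl : PolyTime x l)
    (hf : PolyTime (fun p : ι × γ => (x p.1, p.2)) fun p => f p.1 p.2) :
    PolyTime x fun i => (l i).any (f i) :=
  (all (f := fun i a => !f i a) hl hf.not).not.congr fun i => by
    simp only [List.not_all_eq_any_not, Bool.not_not]

theorem filter {l : ι → List γ} {f : ι → γ → Bool} (hl : PolyTime x l)
    (hf : PolyTime (fun p : ι × γ => (x p.1, p.2)) fun p => f p.1 p.2) :
    PolyTime x fun i => (l i).filter (f i) := by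
  have hbase := refl (fun p : ι × List γ × γ => (x p.1, p.2.1, p.2.2))
  have h := foldr_of_size_le (s := fun i a t => bif f i a then a :: t else t) hl (const x [])
    (cond ((hbase.fst.pair hbase.snd.snd).trans
      (hf.subst fun p : ι × List γ × γ => (p.1, p.2.2)))
      (hbase.snd.snd.cons hbase.snd.fst) hbase.snd.fst) (d := fun i => 1 + size (l i))
    ((PolyBounded.const 1 _).add hl.size_bounded) fun i c a ha => by
      have := size_le_of_mem ha
      cases f i a <;> simp; omega
  refine h.congr fun i => congrArg _ ?_
  generalize l i = t
  induction t with
  | nil => rfl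
  | cons a t ih => cases h : f i a <;> simp [h, ih]

theorem map {l : ι → List γ} {f : ι → γ → β} (hl : PolyTime x l)
    (hf : PolyTime (fun p : ι × γ => (x p.1, p.2)) fun p => f p.1 p.2) :
    PolyTime x fun i => (l i).map (f i) := by
  have hbase := refl (fun p : ι × List β × γ => (x p.1, p.2.1, p.2.2))
  obtain ⟨p, hp⟩ := hf.size_bounded
  have h := foldr_of_size_le (s := fun i a t => f i a :: t) hl (const x [])
    (PolyTime.cons ((hbase.fst.pair hbase.snd.snd).trans
      (hf.subst fun p : ι × List β × γ => (p.1, p.2.2))) hbase.snd.fst)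
    (d := fun i => 1 + p.eval (1 + size (x i) + size (l i)))
    ((PolyBounded.const 1 _).add (.trans ⟨p, fun _ => le_rfl⟩
      (((PolyBounded.const 1 _).add (.refl _)).add hl.size_bounded))) fun i c a ha => by
      have h1 := hp (i, a)
      have h2 : size (x i, a) ≤ 1 + size (x i) + size (l i) := by
        rw [size_pair]; exact Nat.add_le_add_left (size_le_of_mem ha) _
      have h3 := h1.trans (p.eval_nat_mono h2)
      simp only [size_cons] at h3 ⊢
      omega
  exact h.congr fun i => by rw [List.map_eq_foldr]

theorem append {l l' : ι → List β} (hl : PolyTime x l) (hl' : PolyTime x l') :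
    PolyTime x fun i => l i ++ l' i := by
  have h := foldr_of_size_le (s := fun _ a (t : List β) => a :: t) hl hl'
    ((var_snd x).cons (var_fst x)) (d := fun i => 1 + size (l i))
    ((PolyBounded.const 1 _).add hl.size_bounded) fun i c a ha => by
      have := size_le_of_mem ha
      simp only [size_cons]; omega
  exact h.congr fun i => by simp

end PolyTime

/-! ### Natural numbers -/

instance : Coded ℕ := ⟨fun n => Coded.code n.bits⟩

/-- The number with the given binary digits, the least significant one first. -/
def ofBits (l : List Bool) : ℕ := l.foldr Nat.bit 0

theorem ofBits_cons (b : Bool) (l : List Bool) : ofBits (b :: l) = Nat.bit b (ofBits l) := rfl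

theorem ofBits_bits (n : ℕ) : ofBits n.bits = n := by
  induction n using Nat.binaryRec' with
  | zero => rfl
  | bit b n h ih => rw [Nat.bits_append_bit n b h, ofBits_cons, ih]

theorem ofBits_lt (l : List Bool) : ofBits l < 2 ^ l.length := by
  induction l with
  | nil => simp [ofBits]
  | cons b l ih =>
    rw [ofBits_cons, Nat.bit_val, List.length_cons, pow_succ]
    cases b <;> simp <;> omega

theorem size_eq_size_bits (n : ℕ) : size n = size n.bits := rfl

theorem size_bits_le (l : List Bool) : size l ≤ 4 * l.length + 1 := by
  induction l with
  | nil => simp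
  | cons b l ih =>
    have := size_bool_le b
    simp only [size_cons, List.length_cons]; omega

theorem size_nat_le (n : ℕ) : size n ≤ 4 * Nat.size n + 1 := by
  rw [← Nat.size_eq_bits_len]; exact size_bits_le _

theorem natSize_le (n : ℕ) : Nat.size n ≤ size n := by
  rw [← Nat.size_eq_bits_len]; exact length_le_size _

theorem natSize_add_le (m n : ℕ) : Nat.size (m + n) ≤ Nat.size m + Nat.size n + 1 := by
  rw [Nat.size_le]
  have h1 := Nat.lt_size_self m
  have h2 := Nat.lt_size_self n
  have h3 : 2 ^ Nat.size m ≤ 2 ^ (Nat.size m + Nat.size n) := by gcongr <;> omega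
  have h4 : 2 ^ Nat.size n ≤ 2 ^ (Nat.size m + Nat.size n) := by gcongr <;> omega
  rw [pow_succ]; omega

/-- Doubling costs a single digit. The general bound for sums would double the number of digits at
each step of a multiplication. -/
theorem natSize_double_add_le (m n : ℕ) :
    Nat.size (m + m + n) ≤ Nat.size m + (Nat.size n + 2) := by
  rw [Nat.size_le]
  have h1 := Nat.lt_size_self m
  have h2 := Nat.lt_size_self n
  have h3 : 2 ^ Nat.size m ≤ 2 ^ (Nat.size m + Nat.size n) := by gcongr <;> omega
  have h4 : 2 ^ Nat.size n ≤ 2 ^ (Nat.size m + Nat.size n) := by gcongr <;> omega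
  rw [← Nat.add_assoc, pow_succ, pow_succ]; omega

theorem size_tail_le {α : Type*} [Coded α] (l : List α) : size l.tail ≤ size l := by
  cases l <;> simp

theorem size_div2_le (n : ℕ) : size n.div2 ≤ size n := by
  rw [size_eq_size_bits, Nat.div2_bits_eq_tail]; exact size_tail_le _

theorem size_bit_le (b : Bool) (n : ℕ) : size (Nat.bit b n) ≤ size n + 4 := by
  by_cases h : n = 0 → b = true
  · rw [size_eq_size_bits, Nat.bits_append_bit n b h, size_cons]
    have h1 := size_bool_le b
    have h2 := size_eq_size_bits n
    omega
  · push Not at h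
    obtain ⟨rfl, h⟩ := h
    simp [eq_false_of_ne_true h]

/-- Read off a sum from a list of digits, the most significant one first, and a carry. -/
def ofDigitStack (out : List Bool) (n : ℕ) : ℕ := out.foldl (fun n b => Nat.bit b n) n

/-- One step of binary addition with carry; the digits of the sum are stacked. -/
def addStep (s : ℕ × ℕ × Bool × List Bool) : ℕ × ℕ × Bool × List Bool :=
  (s.1.div2, s.2.1.div2,
    (s.1.bodd && s.2.1.bodd || s.2.2.1 && (s.1.bodd || s.2.1.bodd)),
    (s.1.bodd ^^ s.2.1.bodd ^^ s.2.2.1) :: s.2.2.2)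

/-- The loop invariant of addition: the outstanding sum `a + b + carry`, continued by the digits
already produced, always denotes the same number. A single step is the identity of the full adder.
-/
theorem ofDigitStack_addStep (s : ℕ × ℕ × Bool × List Bool) :
    ofDigitStack (addStep s).2.2.2 ((addStep s).1 + (addStep s).2.1 + (addStep s).2.2.1.toNat) =
      ofDigitStack s.2.2.2 (s.1 + s.2.1 + s.2.2.1.toNat) := by
  obtain ⟨a, b, c, out⟩ := s
  simp only [addStep, ofDigitStack, List.foldl_cons]
  congr 1
  rw [Nat.bit_val]
  have ha := Nat.bodd_add_div2 a
  have hb := Nat.bodd_add_div2 b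
  generalize a.bodd = a₀ at *
  generalize b.bodd = b₀ at *
  cases a₀ <;> cases b₀ <;> cases c <;> simp at * <;> omega

theorem ofDigitStack_iterate_addStep (s : ℕ × ℕ × Bool × List Bool) (k : ℕ) :
    ofDigitStack (addStep^[k] s).2.2.2
        ((addStep^[k] s).1 + (addStep^[k] s).2.1 + (addStep^[k] s).2.2.1.toNat) =
      ofDigitStack s.2.2.2 (s.1 + s.2.1 + s.2.2.1.toNat) := by
  induction k with
  | zero => rfl
  | succ k ih => rw [Function.iterate_succ_apply', ofDigitStack_addStep, ih]

theorem iterate_div2_eq_zero {n k : ℕ} (h : n.bits.length ≤ k) : Nat.div2^[k] n = 0 := by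
  rw [Nat.size_eq_bits_len, Nat.size_le] at h
  have key : ∀ k, Nat.div2^[k] n = n / 2 ^ k := by
    intro k
    induction k with
    | zero => simp
    | succ k ih => rw [Function.iterate_succ_apply', ih, Nat.div2_val, Nat.div_div_eq_div_mul,
        pow_succ]
  rw [key, Nat.div_eq_of_lt h]

/-- One step of the comparison of two numbers, the least significant digits first. -/
def ltStep (s : ℕ × ℕ × Bool) : ℕ × ℕ × Bool :=
  (s.1.div2, s.2.1.div2, bif s.1.bodd ^^ s.2.1.bodd then s.2.1.bodd else s.2.2)

/-- The loop invariant of comparison: the remaining high parts decide, and only if they agree does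
the verdict `r` on the low digits count. -/
theorem iterate_ltStep (a b : ℕ) (r : Bool) (k : ℕ) :
    (if (ltStep^[k] (a, b, r)).1 = (ltStep^[k] (a, b, r)).2.1 then (ltStep^[k] (a, b, r)).2.2
      else decide ((ltStep^[k] (a, b, r)).1 < (ltStep^[k] (a, b, r)).2.1)) =
      if a = b then r else decide (a < b) := by
  induction k generalizing a b r with
  | zero => rfl
  | succ k ih =>
    rw [Function.iterate_succ_apply]
    refine (ih _ _ _).trans ?_
    have ha := Nat.bodd_add_div2 a
    have hb := Nat.bodd_add_div2 b
    simp only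
    generalize a.bodd = a₀ at *
    generalize b.bodd = b₀ at *
    generalize a.div2 = a₁ at *
    generalize b.div2 = b₁ at *
    subst ha hb
    cases a₀ <;> cases b₀ <;> cases r <;> simp <;> grind

theorem fst_iterate_addStep (s : ℕ × ℕ × Bool × List Bool) (k : ℕ) :
    (addStep^[k] s).1 = Nat.div2^[k] s.1 ∧ (addStep^[k] s).2.1 = Nat.div2^[k] s.2.1 := by
  induction k with
  | zero => exact ⟨rfl, rfl⟩
  | succ k ih => simp only [Function.iterate_succ_apply', addStep, ih, and_self]

theorem fst_iterate_ltStep (s : ℕ × ℕ × Bool) (k : ℕ) :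
    (ltStep^[k] s).1 = Nat.div2^[k] s.1 ∧ (ltStep^[k] s).2.1 = Nat.div2^[k] s.2.1 := by
  induction k with
  | zero => exact ⟨rfl, rfl⟩
  | succ k ih => simp only [Function.iterate_succ_apply', ltStep, ih, and_self]

/-- Multiplication by repeated doubling. -/
def mulBits (l : List Bool) (b : ℕ) : ℕ := l.foldr (fun c n => n + n + bif c then b else 0) 0

theorem mulBits_eq (l : List Bool) (b : ℕ) : mulBits l b = ofBits l * b := by
  induction l with
  | nil => simp [mulBits, ofBits]
  | cons c l ih =>
    rw [ofBits_cons, Nat.bit_val]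
    change mulBits l b + mulBits l b + _ = _
    rw [ih]
    cases c <;> simp <;> ring

/-! ### Arithmetic in polynomial time -/

namespace PolyTime
variable {ι α β γ : Type*} [Coded α] [Coded β] [Coded γ] {x : ι → α} {a b : ι → ℕ}

theorem natBits (ha : PolyTime x a) : PolyTime x fun i => (a i).bits := ha.congr fun _ => rfl

theorem div2 (ha : PolyTime x a) : PolyTime x fun i => (a i).div2 :=
  ha.natBits.tail.congr fun i => by rw [← Nat.div2_bits_eq_tail]; rfl

theorem bodd (ha : PolyTime x a) : PolyTime x fun i => (a i).bodd :=
  (ha.natBits.headD (const x false)).congr fun i => by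
    rw [Nat.bodd_eq_bits_head]; cases (a i).bits <;> rfl

theorem natBit {c : ι → Bool} (hc : PolyTime x c) (ha : PolyTime x a) :
    PolyTime x fun i => Nat.bit (c i) (a i) := by
  -- Binary expansions have no leading zeros: prepending the digit 0 to the empty expansion must
  -- leave it empty.
  refine (cond (hc.or ha.natBits.isEmpty.not) (hc.cons ha.natBits) (const x [])).congr fun i => ?_
  change Coded.code (Nat.bit (c i) (a i)).bits = _
  congr 1
  by_cases h : a i = 0 → c i = true
  · rw [Nat.bits_append_bit _ _ h]
    have : (c i || !(a i).bits.isEmpty) = true := by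
      by_cases h0 : a i = 0
      · simp [h h0]
      · have := ofBits_bits (a i)
        cases h1 : (a i).bits
        · rw [h1] at this; exact absurd this.symm h0
        · simp
    simp [this]
  · push Not at h
    simp [h.1, eq_false_of_ne_true h.2]

theorem ofBits {l : ι → List Bool} (hl : PolyTime x l) : PolyTime x fun i => ofBits (l i) :=
  foldr_of_size_le (s := fun _ => Nat.bit) hl (const x 0) ((var_snd x).natBit (var_fst x))
    (d := fun _ => 4) (.const _ _) fun _ c a _ => size_bit_le a c

theorem natAdd (ha : PolyTime x a) (hb : PolyTime x b) : PolyTime x fun i => a i + b i := by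
  have hbase := (refl fun p : ι × (ℕ × ℕ × Bool × List Bool) × Bool => (x p.1, p.2.1, p.2.2)).snd.fst
  have hstep : PolyTime (fun p : ι × (ℕ × ℕ × Bool × List Bool) × Bool => (x p.1, p.2.1, p.2.2))
      fun p => addStep p.2.1 :=
    hbase.fst.div2.pair (hbase.snd.fst.div2.pair ((bool_fun₃ (fun a b c => a && b || c && (a || b))
      hbase.fst.bodd hbase.snd.fst.bodd hbase.snd.snd.fst).pair
      ((bool_fun₃ (fun a b c => a ^^ b ^^ c) hbase.fst.bodd hbase.snd.fst.bodd
      hbase.snd.snd.fst).cons hbase.snd.snd.snd)))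
  -- The list is only a clock, long enough to exhaust both numbers. In each step the digit stack
  -- grows by at most 4 and the code of the carry by at most 2.
  have h := foldl_of_size_le (s := fun _ s (_ : Bool) => addStep s) (ha.natBits.append hb.natBits)
    (ha.pair (hb.pair ((const x false).pair (const x [])))) hstep (d := fun _ => 6)
    (.const _ _) fun i c _ _ => by
      simp only [addStep, size_pair, size_cons]
      have h1 := size_div2_le c.1
      have h2 := size_div2_le c.2.1
      have h3 := size_bool_le (c.1.bodd && c.2.1.bodd || c.2.2.1 && (c.1.bodd || c.2.1.bodd))
      have h4 := size_bool_le (c.1.bodd ^^ c.2.1.bodd ^^ c.2.2.1)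
      have h5 := size_pos c.2.2.1
      omega
  -- Both numbers are now zero, so the remaining carry is the leading part of the sum.
  have h' := foldl_of_size_le (s := fun _ n b => Nat.bit b n) h.snd.snd.snd
    (bool_fun Bool.toNat h.snd.snd.fst) ((var_snd x).natBit (var_fst x)) (d := fun _ => 4)
    (.const _ _) fun _ c a _ => size_bit_le a c
  refine h'.congr fun i => congrArg _ ?_
  have h1 := ofDigitStack_iterate_addStep (a i, b i, false, [])
    ((a i).bits ++ (b i).bits).length
  rw [(fst_iterate_addStep _ _).1, (fst_iterate_addStep _ _).2,
    iterate_div2_eq_zero (n := (a i, b i, false, []).1) (by simp),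
    iterate_div2_eq_zero (n := (a i, b i, false, []).2.1) (by simp)] at h1
  simp only [List.foldl_const]
  simpa [ofDigitStack] using h1.symm

theorem natLt (ha : PolyTime x a) (hb : PolyTime x b) :
    PolyTime x fun i => decide (a i < b i) := by
  have hbase := (refl fun p : ι × (ℕ × ℕ × Bool) × Bool => (x p.1, p.2.1, p.2.2)).snd.fst
  have hstep : PolyTime (fun p : ι × (ℕ × ℕ × Bool) × Bool => (x p.1, p.2.1, p.2.2))
      fun p => ltStep p.2.1 :=
    hbase.fst.div2.pair (hbase.snd.fst.div2.pair
      (bool_fun₃ (fun a b c => bif a ^^ b then b else c)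
        hbase.fst.bodd hbase.snd.fst.bodd hbase.snd.snd))
  have h := foldl_of_size_le (s := fun _ s (_ : Bool) => ltStep s) (ha.natBits.append hb.natBits)
    (ha.pair (hb.pair (const x false))) hstep (d := fun _ => 3)
    (.const _ _) fun i c _ _ => by
      simp only [ltStep, size_pair]
      have h1 := size_div2_le c.1
      have h2 := size_div2_le c.2.1
      have h3 := size_bool_le (bif c.1.bodd ^^ c.2.1.bodd then c.2.1.bodd else c.2.2)
      omega
  refine h.snd.snd.congr fun i => congrArg _ ?_
  have h1 := iterate_ltStep (a i) (b i) false ((a i).bits ++ (b i).bits).length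
  rw [(fst_iterate_ltStep _ _).1, (fst_iterate_ltStep _ _).2,
    iterate_div2_eq_zero (n := (a i, b i, false).1) (by simp),
    iterate_div2_eq_zero (n := (a i, b i, false).2.1) (by simp), if_pos rfl] at h1
  simp only [List.foldl_const]
  rw [h1]
  split_ifs with h <;> simp [h]

theorem natEq (ha : PolyTime x a) (hb : PolyTime x b) :
    PolyTime x fun i => decide (a i = b i) :=
  ((natLt ha hb).or (natLt hb ha)).not.congr fun i => congrArg _ (by
    rw [Bool.eq_iff_iff]; simp; omega)

/-- A left fold with natural numbers whose lengths increase by a bounded amount. -/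
theorem foldl_nat {l : ι → List γ} {s : ι → ℕ → γ → ℕ} (hl : PolyTime x l) (ha : PolyTime x a)
    (hs : PolyTime (fun p : ι × ℕ × γ => (x p.1, p.2.1, p.2.2)) fun p => s p.1 p.2.1 p.2.2)
    {d : ι → ℕ} (hd : PolyBounded d fun i => size (x i))
    (hstep : ∀ i c, ∀ a ∈ l i, Nat.size (s i c a) ≤ Nat.size c + d i) :
    PolyTime x fun i => (l i).foldl (s i) (a i) :=
  -- A digit contributes 2 or 4 to the code of a number, depending on its value; growth is therefore
  -- measured by the number of digits.
  foldl_of_measure_le hl ha hs Nat.size (k := 4) (fun n => (size_nat_le n).trans (by omega))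
    natSize_le hd hstep

theorem natMul (ha : PolyTime x a) (hb : PolyTime x b) : PolyTime x fun i => a i * b i := by
  have hbase := refl (fun p : ι × ℕ × Bool => (x p.1, p.2.1, p.2.2))
  -- Horner's scheme, the most significant digit first.
  have h := foldl_nat (s := fun i n c => n + n + bif c then b i else 0) ha.natBits.reverse
    (const x 0) ((hbase.snd.fst.natAdd hbase.snd.fst).natAdd
      (cond hbase.snd.snd (hbase.fst.trans (hb.subst Prod.fst)) (const _ 0)))
    (d := fun i => size (b i) + 2) (hb.size_bounded.add (.const 2 _)) fun i n c _ => ?_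
  · exact h.congr fun i => congrArg _ (by
      rw [List.foldl_reverse, ← mulBits, mulBits_eq, ofBits_bits])
  · refine (natSize_double_add_le _ _).trans ?_
    have := natSize_le (b i)
    cases c <;> simp; omega

theorem listLength {l : ι → List β} (hl : PolyTime x l) : PolyTime x fun i => (l i).length := by
  have h := foldl_nat (s := fun _ n _ => n + 1) hl (const x 0)
    ((var_fst x).natAdd (const _ 1)) (d := fun _ => 2) (.const _ _) fun _ c _ _ =>
      natSize_add_le c 1
  refine h.congr fun i => congrArg _ ?_
  simp [List.foldl_const]

end PolyTime

/-! ### Turing machines from polynomial-time programs -/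

instance {α β : Type*} [Coded α] [Coded β] : Coded (α ⊕ β) :=
  ⟨Sum.elim (fun a => Coded.code (false, a)) fun b => Coded.code (true, b)⟩

theorem PolyTime.sum_cases {ι α β γ δ : Type*} [Coded α] [Coded β] [Coded γ] [Coded δ]
    {x : ι → α} {o : ι → γ ⊕ δ} {y : ι → β} {s : ι → γ → β} {t : ι → δ → β}
    (ho : PolyTime x o)
    (hs : PolyTime (fun p : ι × γ => (x p.1, p.2)) fun p => s p.1 p.2)
    (ht : PolyTime (fun p : ι × δ => (x p.1, p.2)) fun p => t p.1 p.2)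
    (hys : ∀ i a, o i = .inl a → y i = s i a) (hyt : ∀ i a, o i = .inr a → y i = t i a) :
    PolyTime x y := by
  have hright : PolyTime (fun i => o i) fun i => (o i).isRight := by
    -- The code of an element of a sum type is that of the pair of its tag and its content, so the
    -- tag is a first projection.
    let w : ι → Bool × BinTree := fun i =>
      ((o i).isRight, Sum.elim Coded.code Coded.code (o i))
    exact ((refl w).fst).congr_left fun i => by cases h : o i <;> simp [w, h] <;> rfl
  refine ((refl x).pair ho).trans (ite' ((refl fun i => (x i, o i)).snd.trans hright) ?_ ?_)
  · have h1 : PolyTime (fun p : ι × δ => (x p.1, (true, p.2))) fun p => t p.1 p.2 :=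
      PolyTime.trans ((refl (fun p : ι × δ => (x p.1, (true, p.2)))).fst.pair
        (refl (fun p : ι × δ => (x p.1, (true, p.2)))).snd.snd) ht
    have h2 := h1.subst fun i : {i // (o i).isRight = true} => (i.1, (o i).getRight i.2)
    refine (h2.congr_left fun i => ?_).congr fun i => ?_
    · obtain ⟨i, hi⟩ := i
      obtain ⟨a, ha⟩ := Sum.isRight_iff.1 hi
      simp [Coded.code, ha]
    · rw [hyt i _ (Sum.inr_getRight _ i.2).symm]
  · have h1 : PolyTime (fun p : ι × γ => (x p.1, (false, p.2))) fun p => s p.1 p.2 :=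
      PolyTime.trans ((refl (fun p : ι × γ => (x p.1, (false, p.2)))).fst.pair
        (refl (fun p : ι × γ => (x p.1, (false, p.2)))).snd.snd) hs
    have hl : ∀ i : {i // (o i).isRight = false}, (o i).isLeft := fun i => by simpa using i.2
    have h2 := h1.subst fun i : {i // (o i).isRight = false} => (i.1, (o i).getLeft (hl i))
    refine (h2.congr_left fun i => ?_).congr fun i => ?_
    · obtain ⟨a, ha⟩ := Sum.isLeft_iff.1 (hl i)
      simp [Coded.code, ha]
    · rw [hys i _ (Sum.inl_getLeft _ (hl i)).symm]

/-! ### Input and output of the Turing machine -/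

namespace Fragment
open TM2.Stmt

/-- Push the code of the symbol in the register, provided that it belongs to the list. -/
def pushSymbol (q : TM2.Stmt Alphabet Bool Register) :
    List InputSymbol → TM2.Stmt Alphabet Bool Register
  | [] => q
  | s :: l => branch (fun v => decide (v = some s)) (pushStmt (true :: bits s) q)
    (pushSymbol q l)

theorem stepAux_pushSymbol (q : TM2.Stmt Alphabet Bool Register) (i l : List InputSymbol)
    (m : List Bool) {s : InputSymbol} (hs : s ∈ l) :
    TM2.stepAux (pushSymbol q l) (some s) (memory i m [] [] []) =
      TM2.stepAux q (some s) (memory i (true :: (bits s ++ m)) [] [] []) := by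
  induction l with
  | nil => simp at hs
  | cons s' l ih =>
    rw [pushSymbol, TM2.stepAux]
    by_cases h : s = s'
    · subst h
      simp [stepAux_pushStmt]
    · have h' : some s ≠ some s' := fun e => h (Option.some.inj e)
      simp only [h', decide_false, cond_false]
      exact ih ((List.mem_cons.1 hs).resolve_left h)

/-- Move the input to the main stack, coded as a list in reverse order. -/
def readInput : Fragment := loop <| block <|
  pop .input (fun _ s => s) <|
  branch Option.isSome
    (pushSymbol (load (fun _ => none) <| goto fun _ => true)
      [.inl none, .inl (some false), .inl (some true), .inr false, .inr true]) <|
  goto fun _ => false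

/-- The code of `s :: acc` is `true`, the code of `s`, and then the code of `acc`. Pushing on top
therefore builds a list code, in reverse order. -/
theorem exec_readInput (l acc : List InputSymbol) :
    readInput.Exec (memory l (bits acc) [] [] []) false (onMain (bits (l.reverse ++ acc)))
      (l.length + 1) := by
  induction l generalizing acc with
  | nil => exact (exec_block (by simp)).loop_false
  | cons s l ih =>
    rw [List.reverse_cons, List.append_assoc, List.length_cons, Nat.add_comm]
    refine Exec.loop_true (exec_block (S' := memory l (bits (s :: acc)) [] [] []) ?_)
      (ih (s :: acc))
    have hs : s ∈ ([.inl none, .inl (some false), .inl (some true), .inr false, .inr true] :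
        List InputSymbol) := by
      rcases s with (_ | _ | _) | _ | _ <;> simp
    have h := stepAux_pushSymbol (load (fun _ => none) <| goto fun _ => true) l _ (bits acc) hs
    simp only [TM2.stepAux, memory_input, List.head?_cons, List.tail_cons, update_memory_input,
      Option.isSome_some, cond_true, h]
    rfl

/-- The machine that runs a fragment and halts. -/
def machine (F : Fragment) : FinTM2 where
  K := Stack
  k₀ := .input
  k₁ := .main
  Γ := Alphabet
  Λ := F.Label ⊕ Bool
  main := .inl F.entry
  σ := Register
  initialState := none
  Γk₀Fin := inferInstanceAs (Fintype (Option Bool ⊕ Bool))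
  m := Sum.elim F.code fun _ => halt

/-- The additional step executes `halt` at the exit label. -/
theorem Run.iterate_step {F : Fragment} {c : TM2.Cfg Alphabet (F.Label ⊕ Bool) Register}
    {b : Bool} {S : Memory} {n : ℕ} (h : F.Run c b S n) :
    (flip Option.bind F.machine.step)^[n + 1] (some c) =
      some (⟨none, none, S⟩ : TM2.Cfg Alphabet (F.Label ⊕ Bool) Register) := by
  induction h with
  | exit b S => rfl
  | step _ ih => rw [Function.iterate_succ_apply]; exact ih

theorem initList_machine (F : Fragment) (l : List InputSymbol) :
    initList F.machine l = F.start (memory l [] [] [] []) := by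
  simp only [initList, start]
  congr 1
  funext k
  cases k <;> rfl

theorem haltList_machine (F : Fragment) (l : List Bool) :
    haltList F.machine l = (⟨none, none, onMain l⟩ :
      TM2.Cfg Alphabet (F.Label ⊕ Bool) Register) := by
  simp only [haltList]
  congr 1
  funext k
  cases k <;> rfl

end Fragment

open Fragment

/-- Split a reversed input into the instance and the certificate. -/
def splitInput (l : List InputSymbol) : List (Option Bool) × List Bool :=
  l.foldl (fun p s => s.elim (fun a => (a :: p.1, p.2)) fun b => (p.1, b :: p.2)) ([], [])

theorem splitInput_encode (p : List (Option Bool) × List Bool) :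
    splitInput ((encodingProd (encodingList (Option Bool)) (encodingList Bool)).encode p).reverse =
      p := by
  obtain ⟨x, w⟩ := p
  simp only [splitInput, List.foldl_reverse, encodingProd, encodingList, id, List.foldr_append]
  have h1 : ∀ w : List Bool, (w.map Sum.inr).foldr
      (fun (s : InputSymbol) (p : List (Option Bool) × List Bool) =>
        s.elim (fun a => (a :: p.1, p.2)) fun b => (p.1, b :: p.2)) ([], []) = ([], w) := by
    intro w
    induction w with
    | nil => rfl
    | cons b w ih => simp [ih]
  rw [h1]
  induction x with
  | nil => rfl
  | cons a x ih => simp [ih]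

theorem PolyTime.splitInput : PolyTime (fun l : List InputSymbol => l) splitInput := by
  have hbase := refl (fun p : List InputSymbol × (List (Option Bool) × List Bool) × InputSymbol =>
    (p.1, p.2.1, p.2.2))
  have hx := refl (fun l : List InputSymbol => l)
  refine foldl_of_size_le (s := fun _ p (s : InputSymbol) =>
      s.elim (fun a => (a :: p.1, p.2)) fun b => (p.1, b :: p.2)) hx
    (const _ ([], [])) (sum_cases (s := fun p a => (a :: p.2.1.1, p.2.1.2))
      (t := fun p b => (p.2.1.1, b :: p.2.1.2)) hbase.snd.snd ?_ ?_ ?_ ?_)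
    (d := fun _ => 10) (.const _ _) fun i c a _ => ?_
  · have h := refl (fun q : (List InputSymbol × (List (Option Bool) × List Bool) × InputSymbol) ×
      Option Bool => ((q.1.1, q.1.2.1, q.1.2.2), q.2))
    exact (h.snd.cons h.fst.snd.fst.fst).pair h.fst.snd.fst.snd
  · have h := refl (fun q : (List InputSymbol × (List (Option Bool) × List Bool) × InputSymbol) ×
      Bool => ((q.1.1, q.1.2.1, q.1.2.2), q.2))
    exact h.fst.snd.fst.fst.pair (h.snd.cons h.fst.snd.fst.snd)
  · rintro ⟨_, _, _⟩ a rfl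
    rfl
  · rintro ⟨_, _, _⟩ a rfl
    rfl
  · rcases a with (_ | b) | b
    · simp [size_pair]; omega
    · have := size_bool_le b
      simp [size_pair]; omega
    · have := size_bool_le b
      simp [size_pair]; omega

theorem size_inputSymbol_le (s : InputSymbol) : size s ≤ 12 := by
  rcases s with (_ | _ | _) | _ | _ <;> decide

theorem size_input_le (l : List InputSymbol) : size l ≤ 13 * l.length + 1 := by
  induction l with
  | nil => simp
  | cons s l ih =>
    have := size_inputSymbol_le s
    simp only [size_cons, List.length_cons]; omega

/-- A verifier that is computable in polynomial time on coded data is computed by a Turing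
machine in polynomial time. -/
theorem PolyTime.tm2Computable {V : List (Option Bool) × List Bool → Bool}
    (hV : PolyTime (fun p => p) V) :
    Nonempty (TM2ComputableInPolyTime
      (encodingProd (encodingList (Option Bool)) (encodingList Bool)).encode encodeBool V) := by
  obtain ⟨F, t, ⟨p, hp⟩, -, hF⟩ := app hV splitInput
  -- The initial `false` is the code of the empty list, on which the input is accumulated. At the
  -- end the tree code of the answer is replaced by the single bit that `encodeBool` requires.
  let T : Fragment :=
    (pushBits [false]).seq (readInput.seq (F.seq (popBool.bind fun b => pushBits [b])))
  have hexec : ∀ l : List InputSymbol,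
      T.Exec (memory l [] [] [] []) false (onMain [V (_root_.splitInput l.reverse)])
        (1 + ((l.length + 1) + (p.eval (13 * l.length + 1) + (4 + 1)))) := by
    intro l
    have h := hF l.reverse []
    have h0 : (pushBits [false]).Exec (memory l [] [] [] []) false
        (memory l (bits ([] : List InputSymbol)) [] [] []) 1 :=
      exec_block (by simp [stepAux_pushStmt]; rfl)
    have h1 := exec_readInput l []
    have h2 := (exec_popBool (V (_root_.splitInput l.reverse)) []).bind
      (G := fun b => pushBits [b]) (exec_pushBits [V (_root_.splitInput l.reverse)] [])
    simp only [List.append_nil] at h h1 h2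
    refine h0.seq (h1.seq ((h.mono ((hp _).trans (p.eval_nat_mono ?_))).seq h2))
    simpa using size_input_le l.reverse
  choose n hn hrun using hexec
  refine ⟨⟨⟨T.machine, Equiv.refl InputSymbol, Equiv.refl Bool⟩,
    1 + ((Polynomial.X + 1) + (p.comp (13 * Polynomial.X + 1) + 5)) + 1, fun a => ?_⟩⟩
  have h := (hrun ((encodingProd (encodingList (Option Bool))
    (encodingList Bool)).encode a)).iterate_step
  rw [splitInput_encode, ← haltList_machine, ← initList_machine] at h
  have hin : List.map (Equiv.refl InputSymbol).invFun ((encodingProd (encodingList (Option Bool))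
      (encodingList Bool)).encode a) = (encodingProd (encodingList (Option Bool))
      (encodingList Bool)).encode a := List.map_id _
  refine ⟨⟨n ((encodingProd (encodingList (Option Bool))
    (encodingList Bool)).encode a) + 1, ?_⟩, ?_⟩
  · erw [hin]
    exact h
  · refine (Nat.add_le_add_right (hn _) 1).trans (le_of_eq ?_)
    simp

/-! ### Sparse rational optima of linear programs -/

section LinearProgram
open Finset
variable {Ω R : Type*} [Fintype Ω] [Fintype R]

/-- The polyhedron of the nonnegative solutions of a system of linear equations with integer
coefficients and a rational right-hand side. -/
def feasible (A : R → Ω → ℤ) (θ : R → ℚ) : Set (Ω → ℝ) :=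
  {p | (∀ ω, 0 ≤ p ω) ∧ ∀ r, ∑ ω, (A r ω : ℝ) * p ω = θ r}

variable {A : R → Ω → ℤ} {θ : R → ℚ} {r₀ : R}

-- The row `r₀` of ones bounds every coordinate of a nonnegative solution by `θ r₀`.
omit [Fintype R] in
theorem isCompact_feasible (hA : ∀ ω, A r₀ ω = 1) : IsCompact (feasible A θ) := by
  have hclosed : IsClosed (feasible A θ) := by
    refine IsClosed.inter (s₁ := {p : Ω → ℝ | ∀ ω, 0 ≤ p ω}) ?_ ?_
    · simp only [Set.ofPred_forall]
      exact isClosed_iInter fun ω => isClosed_le continuous_const (continuous_apply ω)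
    · change IsClosed {p : Ω → ℝ | ∀ r, ∑ ω, (A r ω : ℝ) * p ω = θ r}
      simp only [Set.ofPred_forall]
      exact isClosed_iInter fun r => isClosed_eq (by fun_prop) continuous_const
  refine (isCompact_Icc (a := (0 : Ω → ℝ)) (b := fun _ => (θ r₀ : ℝ))).of_isClosed_subset hclosed ?_
  rintro p ⟨hp, hp'⟩
  refine ⟨hp, fun ω => ?_⟩
  rw [← hp' r₀]
  simp only [hA, Int.cast_one, one_mul]
  exact single_le_sum (fun ω _ => hp ω) (mem_univ ω)

omit [Fintype R] in
/-- Moving from a feasible point in a direction of the kernel that has a negative coordinate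
until a coordinate vanishes. -/
theorem exists_smaller_support {p d : Ω → ℝ} (hp : p ∈ feasible A θ)
    (hd : ∀ r, ∑ ω, (A r ω : ℝ) * d ω = 0) (hsupp : ∀ ω, p ω = 0 → d ω = 0)
    (hneg : ∃ ω, d ω < 0) :
    ∃ t ≥ (0 : ℝ), (fun ω => p ω + t * d ω) ∈ feasible A θ ∧
      ({ω | p ω + t * d ω ≠ 0} : Finset Ω) ⊂ ({ω | p ω ≠ 0} : Finset Ω) := by
  classical
  obtain ⟨ω₀, h₀⟩ := hneg
  -- The ratio test of the simplex method: `ω₁` is a decreasing coordinate that reaches zero first,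
  -- and the ratio there is the step length.
  obtain ⟨ω₁, h₁, hmin⟩ := exists_min_image ({ω | d ω < 0} : Finset Ω) (fun ω => p ω / -d ω)
    ⟨ω₀, by simpa using h₀⟩
  simp only [mem_filter, mem_univ, true_and] at h₁ hmin
  refine ⟨p ω₁ / -d ω₁, div_nonneg (hp.1 _) (by linarith), ⟨fun ω => ?_, fun r => ?_⟩, ?_⟩
  · rcases lt_or_ge (d ω) 0 with h | h
    · have := hmin ω h
      rw [le_div_iff₀ (by linarith)] at this
      linarith
    · exact add_nonneg (hp.1 ω) (mul_nonneg (div_nonneg (hp.1 _) (by linarith)) h)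
  · have h : ∀ ω, (A r ω : ℝ) * (p ω + p ω₁ / -d ω₁ * d ω) =
        A r ω * p ω + p ω₁ / -d ω₁ * (A r ω * d ω) := fun ω => by ring
    simp only [h]
    rw [sum_add_distrib, ← mul_sum, hd, hp.2 r]
    simp
  · rw [Finset.ssubset_iff_of_subset]
    · refine ⟨ω₁, ?_, ?_⟩
      · simpa using fun h => h₁.ne (hsupp ω₁ h)
      · have : d ω₁ ≠ 0 := h₁.ne
        simp only [mem_filter, mem_univ, true_and, not_not]
        field_simp
        ring
    · intro ω h
      simp only [mem_filter, mem_univ, true_and] at h ⊢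
      intro h'
      exact h (by rw [h', hsupp ω h']; simp)

omit [Fintype R] in
/-- There is an optimal point for which the columns of the support are independent. -/
theorem exists_optimal_linearIndependent (hA : ∀ ω, A r₀ ω = 1) (hne : (feasible A θ).Nonempty)
    (c : Ω → ℝ) :
    ∃ p ∈ feasible A θ, (∀ p' ∈ feasible A θ, ∑ ω, c ω * p' ω ≤ ∑ ω, c ω * p ω) ∧
      LinearIndependent ℝ fun (ω : {ω // p ω ≠ 0}) (r : R) => (A r ω : ℝ) := by
  classical
  obtain ⟨p₀, hp₀, hmax₀⟩ := (isCompact_feasible (θ := θ) hA).exists_isMaxOn hne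
    (f := fun p => ∑ ω, c ω * p ω) (by fun_prop)
  -- Among all optimal points, one with the fewest nonzero entries.
  obtain ⟨p, ⟨hp, hmax⟩, hmin⟩ := exists_minimalFor_of_wellFoundedLT
    (fun p : Ω → ℝ => p ∈ feasible A θ ∧ ∀ p' ∈ feasible A θ, ∑ ω, c ω * p' ω ≤ ∑ ω, c ω * p ω)
    (fun p => #({ω | p ω ≠ 0} : Finset Ω)) ⟨p₀, hp₀, fun p' hp' => hmax₀ hp'⟩
  refine ⟨p, hp, hmax, ?_⟩
  by_contra hdep
  rw [Fintype.not_linearIndependent_iff] at hdep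
  obtain ⟨g, hg, ω₀, hω₀⟩ := hdep
  have key : ∀ g : {ω // p ω ≠ 0} → ℝ,
      ∑ ω, g ω • (fun r => (A r ω : ℝ)) = 0 → g ω₀ ≠ 0 →
      0 ≤ ∑ ω : {ω // p ω ≠ 0}, c ω * g ω → False := by
    intro g hg hω₀ hc
    let d : Ω → ℝ := fun ω => if h : p ω ≠ 0 then g ⟨ω, h⟩ else 0
    have hsum : ∀ f : Ω → ℝ, ∑ ω, f ω * d ω = ∑ ω : {ω // p ω ≠ 0}, f ω * g ω := by
      intro f
      rw [← sum_subset (subset_univ ({ω | p ω ≠ 0} : Finset Ω)) fun ω _ h => by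
        simp only [mem_filter, mem_univ, true_and, not_not] at h; simp [d, h],
        sum_subtype _ (p := fun ω => p ω ≠ 0) (by simp)]
      exact sum_congr rfl fun ω _ => by rw [show d ω = g ω from dif_pos ω.2]
    have hd : ∀ r, ∑ ω, (A r ω : ℝ) * d ω = 0 := by
      intro r
      rw [hsum]
      simpa [mul_comm] using congrFun hg r
    -- By the row of ones the coordinates of `d` sum to zero, so a nonzero `d` has a negative one.
    have hneg : ∃ ω, d ω < 0 := by
      by_contra! h
      have h1 := hd r₀
      simp only [hA, Int.cast_one, one_mul] at h1
      rw [sum_eq_zero_iff_of_nonneg fun ω _ => h ω] at h1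
      have := h1 ω₀ (mem_univ _)
      simp only [d, dif_pos ω₀.2] at this
      exact hω₀ this
    obtain ⟨t, ht, hfeas, hss⟩ := exists_smaller_support hp hd
      (fun ω h => by simp [d, h]) hneg
    have hobj : ∑ ω, c ω * (p ω + t * d ω) = ∑ ω, c ω * p ω + t * ∑ ω, c ω * d ω := by
      rw [mul_sum, ← sum_add_distrib]
      exact sum_congr rfl fun ω _ => by ring
    have h1 : 0 ≤ t * ∑ ω, c ω * d ω := mul_nonneg ht (by rw [hsum]; exact hc)
    have h2 := hmin (j := fun ω => p ω + t * d ω)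
      ⟨hfeas, fun p' hp' => (hmax p' hp').trans (by rw [hobj]; linarith)⟩ (card_le_card hss.subset)
    exact absurd (card_lt_card hss) (not_lt.2 h2)
  -- One of the directions `g` and `-g` does not decrease the objective.
  rcases le_total 0 (∑ ω : {ω // p ω ≠ 0}, c ω * g ω) with h | h
  · exact key g hg hω₀ h
  · refine key (-g) ?_ (by simpa using hω₀) (by simpa using h)
    simpa using hg

/-- The entries of a vector with independent columns on its support have a small common
denominator, by Cramer's rule for the Gram matrix of the columns. -/
theorem exists_common_denominator [Nonempty R] (hA : ∀ r ω, A r ω = 0 ∨ A r ω = 1) {p : Ω → ℝ}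
    (hp : p ∈ feasible A θ)
    (hli : LinearIndependent ℝ fun (ω : {ω // p ω ≠ 0}) (r : R) => (A r ω : ℝ)) :
    ∃ (D : ℕ) (n : Ω → ℕ), 0 < D ∧ (∀ ω, p ω = n ω / D) ∧
      D ≤ (Fintype.card R).factorial * Fintype.card R ^ Fintype.card R * ∏ r, (θ r).den := by
  classical
  set s := {ω // p ω ≠ 0} with hs
  have hcard : Fintype.card s ≤ Fintype.card R :=
    hli.fintype_card_le_finrank.trans_eq (Module.finrank_fintype_fun_eq_card ℝ)
  let M : Matrix R s ℤ := Matrix.of fun r ω => A r ω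
  -- The matrix of columns need not be square. Its Gram matrix is, and over the reals it is
  -- invertible because the columns are independent.
  let G : Matrix s s ℤ := M.transpose * M
  let φ := Int.castRingHom ℝ
  have hGφ : φ.mapMatrix G = (M.map φ).transpose * M.map φ := by
    ext i j
    simp [G, Matrix.mul_apply]
  have hG : G.det ≠ 0 := by
    intro h0
    have h0' : ((M.map φ).transpose * M.map φ).det = 0 := by
      rw [← hGφ, ← RingHom.map_det, h0, map_zero]
    obtain ⟨v, hv, hv'⟩ := Matrix.exists_mulVec_eq_zero_iff.2 h0'
    rw [← Matrix.conjTranspose_eq_transpose_of_trivial,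
      Matrix.conjTranspose_mul_self_mulVec_eq_zero] at hv'
    refine hv (funext (Fintype.linearIndependent_iff.1 hli v (funext fun r => ?_)))
    simpa [Matrix.mulVec, dotProduct, M, φ, mul_comm] using congrFun hv' r
  have hentry : ∀ i j, |G i j| ≤ Fintype.card R := by
    intro i j
    simp only [G, Matrix.mul_apply, Matrix.transpose_apply]
    refine (abs_sum_le_sum_abs _ _).trans ((sum_le_card_nsmul _ _ 1 fun r _ => ?_).trans (by simp))
    rcases hA r i with h | h <;> rcases hA r j with h' | h' <;> simp [M, h, h']
  have hdet : |G.det| ≤ (Fintype.card R).factorial * (Fintype.card R : ℤ) ^ Fintype.card R := by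
    refine (Matrix.det_le (abv := AbsoluteValue.abs) (x := (Fintype.card R : ℤ)) hentry).trans ?_
    rw [nsmul_eq_mul]
    have h1 : 1 ≤ (Fintype.card R : ℤ) := by exact_mod_cast Fintype.card_pos
    gcongr
  -- `Δ` clears the denominators on the right-hand side.
  let Δ : ℕ := ∏ r, (θ r).den
  have hΔ : 0 < Δ := prod_pos fun r _ => (θ r).den_pos
  have hint : ∀ r, ∃ z : ℤ, (θ r : ℝ) * Δ = z := by
    intro r
    obtain ⟨k, hk⟩ : (θ r).den ∣ Δ := dvd_prod_of_mem _ (mem_univ r)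
    refine ⟨(θ r).num * k, ?_⟩
    have h := Rat.mul_den_eq_num (θ r)
    have h' : ((θ r : ℚ) : ℝ) * (θ r).den = (θ r).num := by exact_mod_cast h
    rw [hk]; push_cast
    rw [← mul_assoc, h']
  choose z hz using hint
  let pv : s → ℝ := fun ω => p ω
  have hpv : (M.map φ).mulVec pv = fun r => (θ r : ℝ) := by
    funext r
    rw [← hp.2 r, ← sum_subset (subset_univ ({ω | p ω ≠ 0} : Finset Ω)) fun ω _ h => by
      simp only [mem_filter, mem_univ, true_and, not_not] at h; simp [h],
      sum_subtype _ (p := fun ω => p ω ≠ 0) (by simp)]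
    rfl
  -- From `M p = θ` follows `G p = Mᵀ θ`, hence `det G • p = adj G * Mᵀ θ`, which becomes integral
  -- after multiplication by `Δ`.
  have hmul : ∀ ω : s, p ω * ((G.det : ℤ) : ℝ) * Δ =
      ((G.adjugate * M.transpose).mulVec z ω : ℤ) := by
    intro ω
    have h1 : (φ.mapMatrix G).adjugate.mulVec ((φ.mapMatrix G).mulVec pv) =
        (φ.mapMatrix G).det • pv := by
      rw [Matrix.mulVec_mulVec, Matrix.adjugate_mul, Matrix.smul_mulVec, Matrix.one_mulVec]
    rw [← RingHom.map_det, ← RingHom.map_adjugate, hGφ, ← Matrix.mulVec_mulVec, hpv] at h1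
    have h2 := congrFun h1 ω
    rw [Matrix.mulVec_mulVec] at h2
    have h3 : p ω * ((G.det : ℤ) : ℝ) = (φ G.det • pv) ω := by
      simp [φ, pv, mul_comm]
    rw [h3, ← h2, show (((G.adjugate * M.transpose).mulVec z ω : ℤ) : ℝ) =
      φ ((G.adjugate * M.transpose).mulVec z ω) from rfl, RingHom.map_mulVec]
    have h4 : (G.adjugate * M.transpose).map φ = φ.mapMatrix G.adjugate * (M.map φ).transpose := by
      rw [Matrix.map_mul]; rfl
    rw [h4]
    simp only [Matrix.mulVec, dotProduct, sum_mul]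
    refine sum_congr rfl fun r _ => ?_
    rw [mul_assoc, hz]
    rfl
  have hn : ∀ ω, ∃ n : ℕ, p ω * (G.det.natAbs * Δ : ℕ) = n := by
    intro ω
    by_cases h : p ω = 0
    · exact ⟨0, by simp [h]⟩
    -- As `p` is nonnegative, absolute values may be taken and the sign of the determinant is
    -- irrelevant.
    · refine ⟨((G.adjugate * M.transpose).mulVec z ⟨ω, h⟩).natAbs, ?_⟩
      have h' := congrArg abs (hmul ⟨ω, h⟩)
      rw [abs_mul, abs_mul, abs_of_nonneg (hp.1 ω), Nat.abs_cast] at h'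
      rw [Nat.cast_natAbs, Int.cast_abs, ← h', Nat.cast_mul, Nat.cast_natAbs, Int.cast_abs,
        mul_assoc]
  choose n hn using hn
  have hD : 0 < G.det.natAbs * Δ := Nat.mul_pos (Int.natAbs_pos.2 hG) hΔ
  refine ⟨G.det.natAbs * Δ, n, hD, fun ω => ?_, ?_⟩
  · rw [← hn ω, mul_div_cancel_right₀]
    exact_mod_cast hD.ne'
  · refine Nat.mul_le_mul_right _ ?_
    zify
    exact hdet

/-- A bounded feasible linear program with coefficients `0` and `1` has an optimal point with a
small support and a small common denominator. -/
theorem exists_sparse_rational_optimum (hA : ∀ r ω, A r ω = 0 ∨ A r ω = 1)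
    (hA₀ : ∀ ω, A r₀ ω = 1) (hne : (feasible A θ).Nonempty) (c : Ω → ℝ) :
    ∃ (D : ℕ) (n : Ω → ℕ), 0 < D ∧ (fun ω => (n ω / D : ℝ)) ∈ feasible A θ ∧
      (∀ p ∈ feasible A θ, ∑ ω, c ω * p ω ≤ ∑ ω, c ω * (n ω / D)) ∧
      #({ω | n ω ≠ 0} : Finset Ω) ≤ Fintype.card R ∧
      D ≤ (Fintype.card R).factorial * Fintype.card R ^ Fintype.card R * ∏ r, (θ r).den := by
  classical
  have : Nonempty R := ⟨r₀⟩
  obtain ⟨p, hp, hmax, hli⟩ := exists_optimal_linearIndependent hA₀ hne c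
  obtain ⟨D, n, hD, hn, hbound⟩ := exists_common_denominator hA hp hli
  obtain rfl : p = fun ω => (n ω / D : ℝ) := funext hn
  refine ⟨D, n, hD, hp, hmax, ?_, hbound⟩
  have hcard := hli.fintype_card_le_finrank.trans_eq (Module.finrank_fintype_fun_eq_card ℝ)
  rw [Fintype.card_subtype] at hcard
  convert hcard using 3 with ω
  have : (D : ℝ) ≠ 0 := by exact_mod_cast hD.ne'
  simp [this]

end LinearProgram

/-! ### Optimal distributions of query instances -/

namespace QueryData
open Finset

/-- The coefficients of the linear equations that define the distributions with the given
frequencies. -/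
def coefficient (I : QueryData) : Option (Fin I.N) → (Fin I.K → Bool) → ℤ
  | none, _ => 1
  | some i, ω => if ∀ a ∈ I.family i, ω a = true then 1 else 0

/-- The right-hand side of these equations. -/
def rhs (I : QueryData) : Option (Fin I.N) → ℚ
  | none => 1
  | some i => (I.freq i).val

theorem frequency_eq_sum {K : ℕ} (p : (Fin K → Bool) → ℝ) (S : Finset (Fin K)) :
    frequency p S = ∑ ω, (if ∀ a ∈ S, ω a = true then 1 else 0) * p ω := by
  simp [frequency, sum_filter]

theorem mem_feasible_iff {I : QueryData} {p : (Fin I.K → Bool) → ℝ} :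
    p ∈ feasible I.coefficient I.rhs ↔ I.Satisfies p := by
  simp [feasible, Satisfies, stdSimplex, Option.forall, coefficient, rhs, frequency_eq_sum,
    and_assoc]

/-- The linear program has `N + 1` rows; the row for the total mass has right-hand side 1 and adds
nothing to the product of denominators. -/
theorem exists_rational_optimum {I : QueryData} (hI : I.IsInstance) :
    ∃ (D : ℕ) (n : (Fin I.K → Bool) → ℕ), 0 < D ∧ I.IsOptimal (fun ω => (n ω / D : ℝ)) ∧
      #{ω | n ω ≠ 0} ≤ I.N + 1 ∧
      D ≤ (I.N + 1).factorial * (I.N + 1) ^ (I.N + 1) * ∏ i, (I.freq i).val.den := by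
  obtain ⟨D, n, hD, hfeas, hmax, hcard, hle⟩ := exists_sparse_rational_optimum
    (A := I.coefficient) (θ := I.rhs) (r₀ := none)
    (by rintro (_ | i) ω <;> simp only [coefficient] <;> grind) (fun _ => rfl)
    (hI.consistent.imp fun _ => mem_feasible_iff.2)
    (fun ω => if ∀ a ∈ I.query, ω a = true then 1 else 0)
  refine ⟨D, n, hD, ⟨mem_feasible_iff.1 hfeas, fun p hp => ?_⟩, by simpa using hcard, ?_⟩
  · rw [frequency_eq_sum, frequency_eq_sum]
    exact hmax p (mem_feasible_iff.2 hp)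
  · simpa [Fintype.prod_option, rhs] using hle

/-- Since `N + 1 < 2 ^ (N + 1)`, the factorial and the power contribute `(N + 1) ^ 2` bits each. The
denominators contribute `N * L` bits, which `(N + L) ^ 2` dominates. -/
theorem denominator_lt {I : QueryData} {D L : ℕ} (hL : ∀ i, Nat.size (I.freq i).val.den ≤ L)
    (hD : D ≤ (I.N + 1).factorial * (I.N + 1) ^ (I.N + 1) * ∏ i, (I.freq i).val.den) :
    D < 2 ^ (2 * (I.N + 1) ^ 2 + (I.N + L) ^ 2) := by
  have h1 : ∏ i, (I.freq i).val.den ≤ 2 ^ (I.N * L) := by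
    refine (prod_le_pow_card _ _ (2 ^ L) fun i _ => ?_).trans (by simp [← pow_mul, mul_comm])
    exact (Nat.size_le.1 (hL i)).le
  have h2 : (I.N + 1).factorial ≤ 2 ^ (I.N + 1) ^ 2 :=
    calc (I.N + 1).factorial ≤ (I.N + 1) ^ (I.N + 1) := Nat.factorial_le_pow _
      _ ≤ (2 ^ (I.N + 1)) ^ (I.N + 1) := by gcongr; exact Nat.lt_two_pow_self.le
      _ = _ := by rw [← pow_mul, sq]
  have h3 : (I.N + 1) ^ (I.N + 1) < 2 ^ (I.N + 1) ^ 2 :=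
    calc (I.N + 1) ^ (I.N + 1) < (2 ^ (I.N + 1)) ^ (I.N + 1) := by
          gcongr; exact Nat.lt_two_pow_self
      _ = _ := by rw [← pow_mul, sq]
  have h4 : I.N * L ≤ (I.N + L) ^ 2 := by nlinarith
  calc D ≤ (I.N + 1).factorial * (I.N + 1) ^ (I.N + 1) * ∏ i, (I.freq i).val.den := hD
    _ ≤ 2 ^ (I.N + 1) ^ 2 * (I.N + 1) ^ (I.N + 1) * 2 ^ (I.N * L) := by gcongr
    _ < 2 ^ (I.N + 1) ^ 2 * 2 ^ (I.N + 1) ^ 2 * 2 ^ (I.N * L) := by gcongr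
    _ = 2 ^ (2 * (I.N + 1) ^ 2 + I.N * L) := by rw [← pow_add, ← pow_add, two_mul]
    _ ≤ _ := by gcongr; simp

theorem sum_eq_of_satisfies {I : QueryData} {D : ℕ} {n : (Fin I.K → Bool) → ℕ} (hD : 0 < D)
    (h : I.Satisfies fun ω => (n ω / D : ℝ)) : ∑ ω, n ω = D := by
  have h1 := h.1.2
  rw [← sum_div, div_eq_one_iff_eq (by exact_mod_cast hD.ne')] at h1
  exact_mod_cast h1

theorem exists_canonical_optimum {I : QueryData} (hI : I.IsInstance) {L : ℕ}
    (hL : ∀ i, Nat.size (I.freq i).val.den ≤ L) :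
    ∃ q : (Fin I.K → Bool) → ℚ, I.IsOptimal (fun ω => (q ω : ℝ)) ∧
      #{ω | q ω ≠ 0} ≤ I.N + 1 ∧
      ∀ ω, Nat.size (q ω).den ≤ 2 * (I.N + 1) ^ 2 + (I.N + L) ^ 2 ∧
        Nat.size (q ω).num.natAbs ≤ 2 * (I.N + 1) ^ 2 + (I.N + L) ^ 2 := by
  obtain ⟨D, n, hD, hopt, hcard, hle⟩ := exists_rational_optimum hI
  have hlt := denominator_lt hL hle
  have hD' : (D : ℚ) ≠ 0 := by exact_mod_cast hD.ne'
  refine ⟨fun ω => n ω / D, by simpa using hopt, by simpa [hD.ne'] using hcard, fun ω => ?_⟩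
  have hden : (n ω / D : ℚ).den ∣ D := by
    have := Rat.den_dvd (n ω) D
    exact_mod_cast this
  -- The weights sum to `D`, so an entry is at most 1 and its numerator at most its denominator.
  have hnum : (n ω / D : ℚ).num.natAbs ≤ (n ω / D : ℚ).den := by
    have h1 : n ω ≤ D := by
      rw [← sum_eq_of_satisfies hD hopt.1]
      exact single_le_sum (f := n) (fun _ _ => Nat.zero_le _) (mem_univ ω)
    have h2 : (n ω / D : ℚ) ≤ 1 := div_le_one_of_le₀ (by exact_mod_cast h1) (by positivity)
    have h3 : 0 ≤ (n ω / D : ℚ) := by positivity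
    have h4 := Rat.num_nonneg.2 h3
    rw [Rat.le_iff] at h2
    simp at h2
    omega
  have h1 := Nat.le_of_dvd hD hden
  exact ⟨Nat.size_le.2 (h1.trans_lt hlt), Nat.size_le.2 ((hnum.trans h1).trans_lt hlt)⟩

end QueryData

/-! ### The verifier -/

/-- Words over the binary alphabet. -/
abbrev Word := List Bool

/-- The three words that describe an itemset with a fraction, or an outcome with a weight. -/
abbrev Entry := Word × Word × Word

/-- Prepend a symbol to a list of words; `none` starts a new word. -/
def parseStep (s : Option Bool) (ws : List Word) : List Word :=
  match s, ws with
  | none, ws => [] :: ws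
  | some _, [] => []
  | some b, w :: ws => (b :: w) :: ws

/-- Split a string at the separators. -/
def parseWords (l : List (Option Bool)) : List Word := l.foldr parseStep []

/-- Prepend a word to a list of entries, the first of which is possibly incomplete. -/
def chunkStep (w : Word) (p : List Word × List Entry) : List Word × List Entry :=
  bif p.1.tail.isEmpty then (w :: p.1, p.2)
  else ([], (w, p.1.headD [], p.1.tail.headD []) :: p.2)

/-- Group a list of words into entries. -/
def chunk (ws : List Word) : List Word × List Entry := ws.foldr chunkStep ([], [])

/-- Compare two words letter by letter; the result consists of the remainder of the second word
and the truth value of the comparison. -/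
def walk (r : Bool → Bool → Bool) (u v : Word) : Word × Bool :=
  u.foldl (fun s b => (s.1.tail, s.2 && s.1.head?.any (r b))) (v, true)

/-- Equality of words. -/
def wordEq (u v : Word) : Bool := (walk (· == ·) u v).2 && (walk (· == ·) u v).1.isEmpty

/-- Inclusion of itemsets. -/
def wordSub (u v : Word) : Bool := (walk (fun b c => !b || c) u v).2

/-- The step of the test below: the state consists of the reversed prefix read so far, the
remaining suffix and the result. -/
def lowerStep (fam : List Word) (s : Word × Word × Bool) (b : Bool) : Word × Word × Bool :=
  (b :: s.1, s.2.1.tail, s.2.2 && (!b || fam.any (wordEq (s.1.reverse ++ false :: s.2.1.tail))))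

/-- All itemsets that arise from an itemset by removing an element belong to the family. -/
def closedBelow (fam : List Word) (w : Word) : Bool := (w.foldl (lowerStep fam) ([], w, true)).2.2

/-- The itemsets are distinct and the family is antimonotonic. -/
def closedFamily (fam : List Word) : Bool :=
  fam.all fun w => decide ((fam.filter (wordEq w)).length = 1) && closedBelow fam w

/-- The word is the binary expansion of a number. -/
def isNumeral (w : Word) : Bool := wordEq w (ofBits w).bits

/-- The entry describes an itemset over `K` attributes and a fraction. -/
def validEntry (K : ℕ) (e : Entry) : Bool :=
  decide (e.1.length = K) && ((!e.2.1.isEmpty && (isNumeral e.2.1.tail &&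
    !(e.2.1.headD false && decide (ofBits e.2.1.tail = 0)))) &&
    (isNumeral e.2.2 && !decide (ofBits e.2.2 = 0)))

/-- The string describes query data. -/
def wellFormed (x : List (Option Bool)) : Bool :=
  decide ((x.reverse.headD (some false)).isNone = true) && ((chunk (parseWords x)).1.isEmpty &&
    (!(chunk (parseWords x)).2.isEmpty && (chunk (parseWords x)).2.all
      (validEntry ((chunk (parseWords x)).2.headD ([], [], [])).1.length)))

/-- Prepend a bit to a list of pairs of bits, where a pair stands for a bit or a separator. -/
def pairStep (b : Bool) (p : Option Bool × List (Option Bool)) :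
    Option Bool × List (Option Bool) :=
  match p.1 with
  | none => (some b, p.2)
  | some c => (none, (bif b then some c else none) :: p.2)

/-- The outcomes with weights that a certificate describes. -/
def points (w : List Bool) : List Entry :=
  (chunk (parseWords (w.foldr pairStep (none, [])).2)).2

/-- The total weight of the outcomes that contain an itemset. -/
def weight (B : Word) (pts : List Entry) : ℕ :=
  pts.foldl (fun s e => s + bif wordSub B e.1 then ofBits e.2.1 else 0) 0

/-- The weights have the frequency of the entry, relative to the total weight. -/
def matchesFrequency (pts : List Entry) (e : Entry) : Bool :=
  !e.2.1.headD false &&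
    decide (weight e.1 pts * ofBits e.2.2 = ofBits e.2.1.tail * weight [] pts)

/-- The weights exceed the frequency of the entry, relative to the total weight. -/
def exceedsFrequency (pts : List Entry) (e : Entry) : Bool :=
  e.2.1.headD false ||
    decide (ofBits e.2.1.tail * weight [] pts < weight e.1 pts * ofBits e.2.2)

/-- The weighted outcomes are a certificate for the query and the family. -/
def certifies (es pts : List Entry) : Bool :=
  (decide (0 < weight [] pts) &&
      pts.all fun e => decide (e.1.length = (es.headD ([], [], [])).1.length)) &&
    (es.tail.all (matchesFrequency pts) && exceedsFrequency pts (es.headD ([], [], [])))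

/-- The verifier. -/
def verifier (p : List (Option Bool) × List Bool) : Bool :=
  wellFormed p.1 && (closedFamily ((chunk (parseWords p.1)).2.tail.map fun e => e.1) &&
    certifies (chunk (parseWords p.1)).2 (points p.2))

/-! ### Polynomial running time of the verifier -/

namespace PolyTime
variable {ι α : Type*} [Coded α] {x : ι → α} {u v : ι → Word} {fam : ι → List Word}
  {pts : ι → List Entry} {e : ι → Entry}

theorem parseWords {l : ι → List (Option Bool)} (hl : PolyTime x l) :
    PolyTime x fun i => parseWords (l i) := by
  have hbase := refl (fun p : ι × List Word × Option Bool => (x p.1, p.2.1, p.2.2))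
  have hbit := var (γ := Bool) fun p : ι × List Word × Option Bool => (x p.1, p.2.1, p.2.2)
  have hcons := refl fun q : ((ι × List Word × Option Bool) × Bool) × Word × List Word =>
    (((x q.1.1.1, q.1.1.2.1, q.1.1.2.2), q.1.2), q.2.1, q.2.2)
  have hstep : PolyTime (fun p : ι × List Word × Option Bool => (x p.1, p.2.1, p.2.2))
      fun p => parseStep p.2.2 p.2.1 := by
    refine option_cases (s := fun p b => parseStep (Option.some b) p.2.1) hbase.snd.snd
      ((const _ []).cons hbase.snd.fst) (list_cases (s := fun p w ws => (p.2 :: w) :: ws)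
      hbase.snd.fst.weaken (const _ []) ((hcons.fst.snd.cons hcons.snd.fst).cons hcons.snd.snd)
      ?_ ?_) ?_ ?_
    · rintro ⟨⟨i, _, s⟩, b⟩ rfl
      rfl
    · rintro ⟨⟨i, _, s⟩, b⟩ w ws rfl
      rfl
    · rintro ⟨i, ws, _⟩ rfl
      rfl
    · rintro ⟨i, ws, _⟩ b rfl
      rfl
  refine foldr_of_size_le (s := fun _ => parseStep) hl (const x []) hstep (d := fun _ => 8)
    (.const _ _) ?_
  rintro i ws (_ | b) -
  · simp [parseStep]; omega
  · have := size_bool_le b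
    cases ws <;> simp [parseStep]; omega

theorem chunk {l : ι → List Word} (hl : PolyTime x l) : PolyTime x fun i => chunk (l i) := by
  have hbase := refl (fun p : ι × (List Word × List Entry) × Word => (x p.1, p.2.1, p.2.2))
  have hs := hbase.snd.fst
  refine foldr_of_size_le (s := fun _ => chunkStep) hl (const x ([], [])) (cond hs.fst.tail.isEmpty
    ((hbase.snd.snd.cons hs.fst).pair hs.snd) ((const _ []).pair ((hbase.snd.snd.pair
      ((hs.fst.headD (const _ [])).pair (hs.fst.tail.headD (const _ [])))).cons hs.snd)))
    (d := fun i => size (l i) + 10) (hl.size_bounded.add (.const _ _)) fun i c a ha => ?_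
  have h := size_le_of_mem ha
  obtain ⟨_ | ⟨w, _ | ⟨w', c⟩⟩, es⟩ := c <;>
    simp [chunkStep, size_pair, size_cons] <;> omega

theorem walk (r : Bool → Bool → Bool) (hu : PolyTime x u) (hv : PolyTime x v) :
    PolyTime x fun i => walk r (u i) (v i) := by
  have hbase := refl (fun p : ι × (Word × Bool) × Bool => (x p.1, p.2.1, p.2.2))
  have hs := hbase.snd.fst
  refine foldl_of_size_le
    (s := fun _ (s : Word × Bool) b => (s.1.tail, s.2 && s.1.head?.any (r b))) hu
    (hv.pair (const x true)) (hs.fst.tail.pair (hs.snd.and (option_cases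
      (s := fun p c => r p.2.2 c) hs.fst.head? (const _ false)
      (bool_fun₂ r hbase.snd.snd.weaken
      (var fun p : ι × (Word × Bool) × Bool => (x p.1, p.2.1, p.2.2))) ?_ ?_))) (d := fun _ => 3) (.const _ _) ?_
  · rintro p h
    simp [h]
  · rintro p c h
    simp [h]
  · intro i s b _
    have h1 := size_tail_le s.1
    have h2 := size_bool_le (s.2 && s.1.head?.any (r b))
    simp only [size_pair]
    omega

theorem wordEq (hu : PolyTime x u) (hv : PolyTime x v) :
    PolyTime x fun i => wordEq (u i) (v i) :=
  (walk _ hu hv).snd.and (walk _ hu hv).fst.isEmpty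

theorem wordSub (hu : PolyTime x u) (hv : PolyTime x v) :
    PolyTime x fun i => wordSub (u i) (v i) :=
  (walk _ hu hv).snd

theorem closedBelow (hf : PolyTime x fam) (hu : PolyTime x u) :
    PolyTime x fun i => closedBelow (fam i) (u i) := by
  have hbase := refl (fun p : ι × (Word × Word × Bool) × Bool => (x p.1, p.2.1, p.2.2))
  have hs := hbase.snd.fst
  have hf' := hbase.fst.trans (hf.subst Prod.fst)
  refine PolyTime.snd (PolyTime.snd (foldl_of_size_le (s := fun i => lowerStep (fam i)) hu
    ((const x []).pair (hu.pair (const x true))) ((hbase.snd.snd.cons hs.fst).pair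
      (hs.snd.fst.tail.pair (hs.snd.snd.and (hbase.snd.snd.not.or (hf'.any
        (f := fun p => _root_.wordEq (p.2.1.1.reverse ++ false :: p.2.1.2.1.tail))
        (wordEq (hs.fst.reverse.append ((const _ false).cons hs.snd.fst.tail)).weaken
        (var fun p : ι × (Word × Word × Bool) × Bool => (x p.1, p.2.1, p.2.2))))))))
      (d := fun _ => 8) (.const _ _) ?_))
  intro i s b _
  have h1 := size_tail_le s.2.1
  have h2 := size_bool_le (lowerStep (fam i) s b).2.2
  have h3 := size_bool_le b
  simp only [lowerStep, size_pair, size_cons] at *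
  omega

theorem closedFamily (hf : PolyTime x fam) : PolyTime x fun i => closedFamily (fam i) := by
  refine hf.all (f := fun i w => decide (((fam i).filter (_root_.wordEq w)).length = 1) &&
    _root_.closedBelow (fam i) w) (PolyTime.and (natEq (listLength (filter
      (f := fun p : ι × Word => _root_.wordEq p.2) hf.weaken (wordEq (var x).weaken
        (var fun p : ι × Word => (x p.1, p.2)))))
      (const _ 1)) (closedBelow hf.weaken (var x)))

theorem isNumeral (hu : PolyTime x u) : PolyTime x fun i => isNumeral (u i) :=
  wordEq hu hu.ofBits.natBits

theorem validEntry {K : ι → ℕ} (hK : PolyTime x K) (he : PolyTime x e) :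
    PolyTime x fun i => validEntry (K i) (e i) :=
  (natEq he.fst.listLength hK).and ((he.snd.fst.isEmpty.not.and (he.snd.fst.tail.isNumeral.and
    ((he.snd.fst.headD (const x false)).and
      (natEq he.snd.fst.tail.ofBits (const x 0))).not)).and
    (he.snd.snd.isNumeral.and (natEq he.snd.snd.ofBits (const x 0)).not))

theorem wellFormed {l : ι → List (Option Bool)} (hl : PolyTime x l) :
    PolyTime x fun i => wellFormed (l i) := by
  have hc := hl.parseWords.chunk
  have hnone : PolyTime x fun i =>
      decide (((l i).reverse.headD (Option.some false)).isNone = true) :=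
    option_cases (n := fun _ => true) (s := fun _ _ => false) 
      (hl.reverse.headD (const x (Option.some false)))
      (const x true) (const _ false) (fun i h => by rw [h]; rfl)
      fun i a h => by rw [h]; rfl
  exact hnone.and (hc.fst.isEmpty.and (hc.snd.isEmpty.not.and (hc.snd.all
    (f := fun i => _root_.validEntry
      ((_root_.chunk (_root_.parseWords (l i))).2.headD ([], [], [])).1.length)
    (validEntry (hc.snd.headD (const x _)).fst.listLength.weaken (var x)))))

theorem points (hu : PolyTime x u) : PolyTime x fun i => points (u i) := by
  have hbase := refl (fun p : ι × (Option Bool × List (Option Bool)) × Bool =>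
    (x p.1, p.2.1, p.2.2))
  refine PolyTime.snd (chunk (parseWords (PolyTime.snd (foldr_of_size_le (s := fun _ => pairStep)
    hu (const x (none, [])) (option_cases
      (s := fun p c => (none, (bif p.2.2 then Option.some c else none) :: p.2.1.2))
      hbase.snd.fst.fst (hbase.snd.snd.some.pair hbase.snd.fst.snd)
      ((const _ none).pair ((cond hbase.snd.snd.weaken (var fun
        p : ι × (Option Bool × List (Option Bool)) × Bool => (x p.1, p.2.1, p.2.2)).some
        (const _ none)).cons
        hbase.snd.fst.snd.weaken)) ?_ ?_) (d := fun _ => 10) (.const _ _) ?_))))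
  · rintro ⟨i, ⟨_, l⟩, b⟩ rfl
    rfl
  · rintro ⟨i, ⟨_, l⟩, b⟩ c rfl
    rfl
  · rintro i ⟨_ | c, l⟩ b -
    · have := size_bool_le b
      simp [pairStep, size_pair]
      omega
    · have := size_bool_le c
      cases b <;> simp [pairStep, size_pair]
      all_goals omega

theorem weight (hu : PolyTime x u) (hp : PolyTime x pts) :
    PolyTime x fun i => weight (u i) (pts i) := by
  have hbase := refl (fun p : ι × ℕ × Entry => (x p.1, p.2.1, p.2.2))
  refine foldl_nat
    (s := fun i n (e : Entry) => n + bif _root_.wordSub (u i) e.1 then _root_.ofBits e.2.1 else 0)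
    hp (const x 0) (hbase.snd.fst.natAdd (cond (wordSub (hbase.fst.trans (hu.subst Prod.fst))
      hbase.snd.snd.fst) hbase.snd.snd.snd.fst.ofBits (const _ 0)))
    (d := fun i => size (pts i) + 1) (hp.size_bounded.add (.const 1 _)) fun i n e he => ?_
  refine (natSize_add_le _ _).trans ?_
  have h1 := size_le_of_mem he
  have h2 := Nat.size_le.2 (ofBits_lt e.2.1)
  have h3 := length_le_size e.2.1
  simp only [size_pair] at h1
  cases _root_.wordSub (u i) e.1 <;> simp
  omega

theorem matchesFrequency (hp : PolyTime x pts) (he : PolyTime x e) :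
    PolyTime x fun i => matchesFrequency (pts i) (e i) :=
  (he.snd.fst.headD (const x false)).not.and
    (natEq ((weight he.fst hp).natMul he.snd.snd.ofBits)
      (he.snd.fst.tail.ofBits.natMul (weight (const x []) hp)))

theorem exceedsFrequency (hp : PolyTime x pts) (he : PolyTime x e) :
    PolyTime x fun i => exceedsFrequency (pts i) (e i) :=
  (he.snd.fst.headD (const x false)).or
    (natLt (he.snd.fst.tail.ofBits.natMul (weight (const x []) hp))
      ((weight he.fst hp).natMul he.snd.snd.ofBits))

theorem certifies {es : ι → List Entry} (hes : PolyTime x es) (hp : PolyTime x pts) :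
    PolyTime x fun i => certifies (es i) (pts i) := by
  have hq := hes.headD (const x ([], [], []))
  exact ((natLt (const x 0) (weight (const x []) hp)).and (hp.all
      (f := fun i e => decide (e.1.length = ((es i).headD ([], [], [])).1.length))
      (natEq (var x).fst.listLength hq.fst.listLength.weaken))).and
    ((hes.tail.all (f := fun i => _root_.matchesFrequency (pts i))
      (matchesFrequency hp.weaken (var x))).and (exceedsFrequency hp hq))

theorem verifier : PolyTime (fun p : List (Option Bool) × List Bool => p) verifier := by
  have h := refl (fun p : List (Option Bool) × List Bool => p)
  have hc := h.fst.parseWords.chunk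
  exact h.fst.wellFormed.and ((closedFamily (hc.snd.tail.map (f := fun _ e => e.1)
    (var fun p : List (Option Bool) × List Bool => p).fst)).and (certifies hc.snd h.snd.points))

end PolyTime

/-! ### Reading query data -/

theorem encodeNat_eq_bits (n : ℕ) : encodeNat n = n.bits := by
  have key : ∀ p : PosNum, encodePosNum p = (p : ℕ).bits := by
    intro p
    induction p with
    | one => simp [encodePosNum]
    | bit0 p ih =>
      have h : ((PosNum.bit0 p : PosNum) : ℕ) = Nat.bit false p := by
        rw [PosNum.cast_bit0, Nat.bit_val]; simp; ring
      rw [h, Nat.bits_append_bit _ _ fun h0 => absurd h0 (PosNum.cast_pos p).ne', encodePosNum, ih]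
    | bit1 p ih =>
      have h : ((PosNum.bit1 p : PosNum) : ℕ) = Nat.bit true p := by
        rw [PosNum.cast_bit1, Nat.bit_val]; simp; ring
      rw [h, Nat.bits_append_bit _ _ fun _ => rfl, encodePosNum, ih]
  rw [encodeNat]
  conv_rhs => rw [← Num.to_of_nat n]
  cases (n : Num) with
  | zero => simp [encodeNum]
  | pos p => simpa [encodeNum] using key p

open QueryData (encodeWord)

theorem parseWords_encode (ws : List Word) : parseWords (ws.map encodeWord).flatten = ws := by
  induction ws with
  | nil => rfl
  | cons w ws ih =>
    simp only [List.map_cons, List.flatten_cons]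
    generalize (ws.map encodeWord).flatten = l at ih ⊢
    induction w with
    | nil => simp only [encodeWord, parseWords] at *; simp [parseStep, ih]
    | cons b w ihw =>
      change parseStep (some b) (parseWords (encodeWord w ++ l)) = _
      rw [ihw]
      rfl

/-- The final separator is essential: the parser discards bits that no separator follows. -/
theorem encode_parseWords (l : List (Option Bool)) :
    ((parseWords (l ++ [none])).map encodeWord).flatten = l ++ [none] := by
  have hne : ∀ l, parseWords (l ++ [none]) ≠ [] := by
    intro l
    induction l with
    | nil => simp [parseWords, parseStep]
    | cons s l ih =>
      change parseStep s (parseWords (l ++ [none])) ≠ []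
      cases h : parseWords (l ++ [none])
      · exact absurd h ih
      · cases s <;> simp [parseStep]
  induction l with
  | nil => rfl
  | cons s l ih =>
    change ((parseStep s (parseWords (l ++ [none]))).map encodeWord).flatten = s :: (l ++ [none])
    cases h : parseWords (l ++ [none])
    · exact absurd h (hne l)
    · rw [h] at ih
      rw [← ih]
      cases s <;> simp [parseStep, encodeWord]

/-- The three words of an entry. -/
def Entry.words (e : Entry) : List Word := [e.1, e.2.1, e.2.2]

theorem chunk_words (es : List Entry) : chunk (es.map Entry.words).flatten = ([], es) := by
  induction es with
  | nil => rfl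
  | cons e es ih =>
    change chunkStep e.1 (chunkStep e.2.1 (chunkStep e.2.2 (chunk (es.map Entry.words).flatten))) = _
    rw [ih]
    rfl

/-- The length bound is part of the induction because `chunkStep` would lose words if three or more
were waiting. -/
theorem words_chunk (ws : List Word) :
    (chunk ws).1 ++ ((chunk ws).2.map Entry.words).flatten = ws ∧ (chunk ws).1.length ≤ 2 := by
  induction ws with
  | nil => exact ⟨rfl, by simp [chunk]⟩
  | cons w ws ih =>
    change (chunkStep w (chunk ws)).1 ++ ((chunkStep w (chunk ws)).2.map Entry.words).flatten = _ ∧ _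
    change _ ∧ (chunkStep w (chunk ws)).1.length ≤ 2
    generalize chunk ws = c at ih ⊢
    obtain ⟨_ | ⟨u, _ | ⟨v, _ | _⟩⟩, es⟩ := c
    · simpa [chunkStep] using ih
    · simpa [chunkStep] using ih
    · simpa [chunkStep, Entry.words] using ih
    · simp at ih

theorem walk_cons (r : Bool → Bool → Bool) (b : Bool) (u v : Word) :
    walk r (b :: u) v = ((walk r u v.tail).1, v.head?.any (r b) && (walk r u v.tail).2) := by
  have key : ∀ (u v : Word) (c : Bool),
      u.foldl (fun (s : Word × Bool) b => (s.1.tail, s.2 && s.1.head?.any (r b))) (v, c) =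
        ((walk r u v).1, c && (walk r u v).2) := by
    intro u
    induction u with
    | nil => simp [walk]
    | cons b u ih => intro v c; rw [walk, List.foldl_cons, List.foldl_cons, ih, ih, Bool.true_and, Bool.and_assoc]
  rw [walk, List.foldl_cons, key, Bool.true_and]

theorem wordEq_eq (u v : Word) : wordEq u v = decide (u = v) := by
  induction u generalizing v with
  | nil => cases v <;> simp [wordEq, walk]
  | cons b u ih =>
    have h := ih v.tail
    simp only [wordEq] at h
    rw [wordEq, walk_cons, Bool.and_assoc, h]
    cases v
    · simp
    · rw [Bool.eq_iff_iff]
      simp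
      exact fun _ => decide_eq_true_iff

theorem wordSub_ofFn {K : ℕ} (f g : Fin K → Bool) :
    wordSub (List.ofFn f) (List.ofFn g) = decide (∀ a, f a = true → g a = true) := by
  induction K with
  | zero => simp [wordSub, walk]
  | succ K ih =>
    have h := ih (fun a => f a.succ) fun a => g a.succ
    simp only [wordSub] at h
    rw [wordSub, List.ofFn_succ, List.ofFn_succ, walk_cons, List.tail_cons, h]
    rw [Bool.eq_iff_iff]
    cases hf : f 0 <;> simp [Fin.forall_fin_succ, hf]

theorem closedBelow_iff (fam : List Word) (w : Word) :
    closedBelow fam w = true ↔ ∀ p s, w = p ++ true :: s → p ++ false :: s ∈ fam := by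
  -- Generalised to an intermediate state with reversed prefix `r` and remaining suffix `s`.
  have key : ∀ (s r : Word) (c : Bool), (s.foldl (lowerStep fam) (r, s, c)).2.2 = true ↔
      c = true ∧ ∀ p t, s = p ++ true :: t → r.reverse ++ (p ++ false :: t) ∈ fam := by
    intro s
    induction s with
    | nil => simp
    | cons b s ih =>
      intro r c
      rw [List.foldl_cons]
      simp only [lowerStep, List.tail_cons]
      rw [ih]
      simp only [wordEq_eq, Bool.and_eq_true, Bool.or_eq_true, Bool.not_eq_true', List.any_eq_true,
        decide_eq_true_eq, exists_eq_right', and_assoc, List.reverse_cons, List.append_assoc,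
        List.singleton_append]
      refine and_congr_right fun _ => ⟨?_, fun h => ⟨?_, fun p t hp => ?_⟩⟩
      · rintro ⟨h1, h2⟩ (_ | ⟨b', p⟩) t hp
        · simp only [List.nil_append, List.cons.injEq] at hp
          obtain ⟨rfl, rfl⟩ := hp
          simpa using h1
        · simp only [List.cons_append, List.cons.injEq] at hp
          obtain ⟨rfl, hp⟩ := hp
          exact h2 p t hp
      · cases b
        · exact .inl rfl
        · exact .inr (h [] s rfl)
      · exact h (b :: p) t (by rw [hp]; rfl)
  simpa [closedBelow] using key w [] true

namespace QueryData

/-- An itemset and a fraction as an entry. -/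
def entry {K : ℕ} (S : Finset (Fin K)) (r : Fraction) : Entry :=
  (itemsetBits S, decide (r.num < 0) :: encodeNat r.num.natAbs, encodeNat r.den)

/-- The entries of the query and of the family. -/
def entries (I : QueryData) : List Entry :=
  entry I.query I.threshold :: List.ofFn fun i => entry (I.family i) (I.freq i)

theorem words_eq (I : QueryData) : I.words = (I.entries.map Entry.words).flatten := by
  simp only [words, entries, List.map_cons, List.flatten_cons, List.map_ofFn]
  rfl

theorem chunk_encode (I : QueryData) : chunk (parseWords I.encode) = ([], I.entries) := by
  rw [encode, parseWords_encode, words_eq, chunk_words]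

theorem length_itemsetBits {K : ℕ} (S : Finset (Fin K)) : (itemsetBits S).length = K := by
  simp [itemsetBits]

theorem isNumeral_iff (w : Word) : isNumeral w = true ↔ encodeNat (ofBits w) = w := by
  rw [isNumeral, wordEq_eq, encodeNat_eq_bits, decide_eq_true_eq, eq_comm]

theorem ofBits_encodeNat (n : ℕ) : ofBits (encodeNat n) = n := by
  rw [encodeNat_eq_bits, ofBits_bits]

theorem validEntry_iff (K : ℕ) (e : Entry) :
    validEntry K e = true ↔ ∃ (S : Finset (Fin K)) (r : Fraction), e = entry S r := by
  obtain ⟨u, v, w⟩ := e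
  constructor
  · simp only [validEntry, Bool.and_eq_true, isNumeral_iff, decide_eq_true_eq,
      Bool.not_eq_true', decide_eq_false_iff_not]
    rintro ⟨rfl, ⟨hv, hv', hs⟩, hw, hd⟩
    obtain _ | ⟨s, v⟩ := v
    · simp at hv
    simp only [List.tail_cons, List.headD_cons] at hv' hs
    refine ⟨({a | u[a] = true} : Finset (Fin u.length)),
      ⟨if s then -(ofBits v : ℤ) else ofBits v, ofBits w, Nat.pos_of_ne_zero hd⟩, ?_⟩
    refine Prod.ext ?_ (Prod.ext ?_ hw.symm)
    · simp only [entry, itemsetBits]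
      refine List.ext_getElem (by simp) fun i h1 h2 => ?_
      simp
    · cases s
      · simp [entry, hv']
      -- The check `hs` excludes a negative zero, which is not an encoding of any integer.
      · have : ofBits v ≠ 0 := by
          rw [Bool.true_and] at hs
          exact of_decide_eq_false hs
        simp [entry, hv', Nat.pos_of_ne_zero this]
  · rintro ⟨S, r, h⟩
    obtain ⟨rfl, rfl, rfl⟩ : u = _ ∧ v = _ ∧ w = _ := by simpa [entry] using h
    simp only [validEntry, Bool.and_eq_true, isNumeral_iff, decide_eq_true_eq,
      Bool.not_eq_true', decide_eq_false_iff_not, ofBits_encodeNat, List.tail_cons,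
      List.headD_cons, length_itemsetBits]
    refine ⟨trivial, ⟨by simp, trivial, ?_⟩, trivial, r.den_pos.ne'⟩
    simp
    omega

theorem wellFormed_encode (I : QueryData) : wellFormed I.encode = true := by
  have hlast : ∃ l, I.encode = l ++ [none] := by
    have hne : I.words ≠ [] := by simp [words, entryWords]
    refine ⟨((I.words.dropLast.map encodeWord).flatten ++ (I.words.getLast hne).map some), ?_⟩
    conv_lhs => rw [encode, ← List.dropLast_append_getLast hne]
    simp [encodeWord]
  obtain ⟨l, hl⟩ := hlast
  simp only [wellFormed, chunk_encode]
  simp only [hl, Bool.and_eq_true, List.all_eq_true, entries, List.headD_cons]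
  refine ⟨by simp, rfl, rfl, fun e he => ?_⟩
  rw [entry, length_itemsetBits, validEntry_iff]
  rcases List.mem_cons.1 he with rfl | he
  · exact ⟨_, _, rfl⟩
  · obtain ⟨i, rfl⟩ := (List.mem_ofFn' _ _).1 he
    exact ⟨_, _, rfl⟩

/-- Needed for soundness: the language consists of encodings only, so a string that passes the
syntactic test must be one. -/
theorem exists_encode_eq {x : List (Option Bool)} (hx : wellFormed x = true) :
    ∃ I : QueryData, I.encode = x := by
  simp only [wellFormed, Bool.and_eq_true, decide_eq_true_eq, List.all_eq_true] at hx
  obtain ⟨h1, h2, h3, h4⟩ := hx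
  obtain ⟨l, rfl⟩ : ∃ l, x = l ++ [none] := by
    rcases List.eq_nil_or_concat x with rfl | ⟨l, s, rfl⟩
    · simp at h1
    · refine ⟨l, ?_⟩
      simp at h1
      simp [h1]
  have h5 := (words_chunk (parseWords (l ++ [none]))).1
  have h6 := encode_parseWords l
  rw [List.isEmpty_iff.1 h2, List.nil_append] at h5
  rw [← h5] at h6
  obtain ⟨q, fam, hes⟩ : ∃ q fam, (chunk (parseWords (l ++ [none]))).2 = q :: fam := by
    cases h : (chunk (parseWords (l ++ [none]))).2
    · simp [h] at h3
    · exact ⟨_, _, rfl⟩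
  rw [hes] at h4 h6
  simp only [List.headD_cons, validEntry_iff] at h4
  obtain ⟨B, b, hq⟩ := h4 q List.mem_cons_self
  choose S r hSr using fun i : Fin fam.length =>
    h4 (fam.get i) (List.mem_cons_of_mem _ (List.get_mem _ _))
  refine ⟨⟨q.1.length, fam.length, S, r, B, b⟩, ?_⟩
  rw [encode, words_eq, ← h6, entries]
  simp only
  rw [← hq, ← funext hSr, List.ofFn_get]

end QueryData

/-! ### Correctness of the verifier -/

namespace QueryData

theorem itemsetBits_injective {K : ℕ} :
    Function.Injective (itemsetBits : Finset (Fin K) → List Bool) := by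
  intro S T h
  simp only [itemsetBits, List.ofFn_inj] at h
  ext a
  simpa using congrFun h a

theorem itemsetBits_erase {K : ℕ} (S : Finset (Fin K)) (a : Fin K) :
    itemsetBits (S.erase a) = (itemsetBits S).set a false := by
  refine List.ext_getElem (by simp [itemsetBits]) fun i h1 h2 => ?_
  simp only [itemsetBits, List.getElem_ofFn, Finset.mem_erase, List.getElem_set]
  by_cases h : (a : ℕ) = i
  · subst h; simp
  · simp [h, Fin.ext_iff, Ne.symm h]

theorem closedBelow_itemsetBits {K : ℕ} (fam : List Word) (S : Finset (Fin K)) :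
    closedBelow fam (itemsetBits S) = true ↔ ∀ a ∈ S, itemsetBits (S.erase a) ∈ fam := by
  rw [closedBelow_iff]
  constructor
  · intro h a ha
    have hlen : (a : ℕ) < (itemsetBits S).length := by simp [itemsetBits]
    have hget : (itemsetBits S)[(a : ℕ)] = true := by simp [itemsetBits, ha]
    have h1 := h ((itemsetBits S).take a) ((itemsetBits S).drop (a + 1)) (by
      rw [← hget, List.getElem_cons_drop, List.take_append_drop])
    rwa [itemsetBits_erase, List.set_eq_take_append_cons_drop, if_pos hlen]
  · intro h p s hp
    have hlen : p.length < K := by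
      have := congrArg List.length hp
      simp [itemsetBits] at this
      omega
    have ha : (⟨p.length, hlen⟩ : Fin K) ∈ S := by
      have h1 : (itemsetBits S)[p.length]? = some true := by rw [hp]; simp
      simpa [itemsetBits, hlen] using h1
    have h1 := h _ ha
    rw [itemsetBits_erase, hp] at h1
    simpa using h1

/-- Every subset is reached by removing one element at a time. This replaces a test of exponentially
many subsets by one for each element of each itemset. -/
theorem antimonotonic_iff {K N : ℕ} (f : Fin N → Finset (Fin K)) :
    (∀ i, ∀ T ⊆ f i, ∃ j, f j = T) ↔ ∀ i, ∀ a ∈ f i, ∃ j, f j = (f i).erase a := by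
  refine ⟨fun h i a _ => h i _ (Finset.erase_subset _ _), fun h => ?_⟩
  -- `n` bounds the number of elements still to be removed.
  have key : ∀ n i T, T ⊆ f i → (f i).card ≤ T.card + n → ∃ j, f j = T := by
    intro n
    induction n with
    | zero => exact fun i T hT hc => ⟨i, (Finset.eq_of_subset_of_card_le hT hc).symm⟩
    | succ n ih =>
      intro i T hT hc
      by_cases hTi : f i = T
      · exact ⟨i, hTi⟩
      · obtain ⟨a, ha, haT⟩ := Finset.exists_of_ssubset (hT.ssubset_of_ne (Ne.symm hTi))
        obtain ⟨j, hj⟩ := h i a ha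
        refine ih j T ?_ ?_
        · rw [hj]; exact Finset.subset_erase.2 ⟨hT, haT⟩
        · rw [hj, Finset.card_erase_of_mem ha]; omega
  exact fun i T hT => key (f i).card i T hT (by omega)

theorem closedFamily_iff (I : QueryData) :
    closedFamily (I.entries.tail.map fun e => e.1) = true ↔
      Function.Injective I.family ∧ ∀ i, ∀ T ⊆ I.family i, ∃ j, I.family j = T := by
  have hfam : (I.entries.tail.map fun e => e.1) = List.ofFn fun i => itemsetBits (I.family i) := by
    simp only [entries, List.tail_cons, List.map_ofFn]
    rfl
  have hcount : ∀ (w : Word) (fam : List Word), (fam.filter (wordEq w)).length = fam.count w := by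
    intro w fam
    rw [List.count_eq_length_filter]
    congr 2
    funext v
    rw [wordEq_eq, Bool.eq_iff_iff, beq_iff_eq, decide_eq_true_iff]
    exact eq_comm
  rw [hfam, antimonotonic_iff]
  simp only [closedFamily, List.all_eq_true, Bool.and_eq_true, decide_eq_true_eq, hcount,
    forall_and]
  refine and_congr ?_ ?_
  · rw [← List.nodup_iff_count_eq_one, List.nodup_ofFn]
    exact itemsetBits_injective.of_comp_iff I.family
  · simp only [List.mem_ofFn', Set.mem_range, forall_exists_index, forall_apply_eq_imp_iff,
      closedBelow_itemsetBits,
      itemsetBits_injective.eq_iff]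

/-- The outcome of an entry. -/
def outcome (K : ℕ) (e : Entry) : Fin K → Bool := fun a => e.1.getD a false

/-- The total weight of an outcome. -/
def multiplicity {K : ℕ} (pts : List Entry) (ω : Fin K → Bool) : ℕ :=
  (pts.map fun e => if outcome K e = ω then ofBits e.2.1 else 0).sum

theorem ofFn_outcome {K : ℕ} {e : Entry} (he : e.1.length = K) :
    List.ofFn (outcome K e) = e.1 := by
  refine List.ext_getElem (by simp [he]) fun i h1 h2 => ?_
  simp [outcome, h2]

theorem weight_eq_sum (B : Word) (pts : List Entry) :
    weight B pts = (pts.map fun e => if wordSub B e.1 then ofBits e.2.1 else 0).sum := by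
  have key : ∀ (pts : List Entry) (n : ℕ),
      pts.foldl (fun s e => s + bif wordSub B e.1 then ofBits e.2.1 else 0) n =
        n + (pts.map fun e => if wordSub B e.1 then ofBits e.2.1 else 0).sum := by
    intro pts
    induction pts with
    | nil => simp
    | cons e pts ih =>
      intro n
      rw [List.foldl_cons, ih, List.map_cons, List.sum_cons, Nat.add_assoc, cond_eq_ite]
  rw [weight, key, Nat.zero_add]

/-- Every listed point belongs to exactly one outcome, so the two summations can be exchanged;
repetitions in a certificate simply add up. -/
theorem frequency_multiplicity {K : ℕ} (pts : List Entry) (S : Finset (Fin K)) :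
    frequency (multiplicity pts) S = (pts.map fun e =>
      if ∀ a ∈ S, outcome K e a = true then ofBits e.2.1 else 0).sum := by
  induction pts with
  | nil => simp [frequency, multiplicity]
  | cons e pts ih =>
    rw [List.map_cons, List.sum_cons, ← ih]
    simp only [frequency, multiplicity, List.map_cons, List.sum_cons, Finset.sum_add_distrib]
    congr 1
    simp

theorem weight_itemsetBits {K : ℕ} {pts : List Entry} (h : ∀ e ∈ pts, e.1.length = K)
    (S : Finset (Fin K)) : weight (itemsetBits S) pts = frequency (multiplicity pts) S := by
  rw [weight_eq_sum, frequency_multiplicity]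
  congr 1
  refine List.map_congr_left fun e he => ?_
  conv_lhs => rw [← ofFn_outcome (h e he), itemsetBits, wordSub_ofFn]
  simp

/-- The empty word passes the inclusion test against every word, so it measures the total weight. -/
theorem weight_nil (K : ℕ) (pts : List Entry) :
    weight [] pts = ∑ ω : Fin K → Bool, multiplicity pts ω := by
  have h := frequency_multiplicity pts (∅ : Finset (Fin K))
  simp only [Finset.notMem_empty, false_implies, implies_true, if_true, frequency,
    Finset.filter_true] at h
  rw [h, weight_eq_sum]
  simp [wordSub, walk]

theorem frequency_div {K : ℕ} (n : (Fin K → Bool) → ℕ) (D : ℕ) (S : Finset (Fin K)) :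
    frequency (fun ω => (n ω / D : ℝ)) S = (frequency n S : ℕ) / D := by
  simp [frequency, Finset.sum_div]

/-- Cross-multiplication by the positive denominators. Weights are nonnegative, so a negative number
is never matched and the rest is a comparison of naturals. -/
theorem matchesFrequency_iff {K D : ℕ} {pts : List Entry} (h : ∀ e ∈ pts, e.1.length = K)
    (hD : weight [] pts = D) (hpos : 0 < D) (S : Finset (Fin K)) (r : Fraction) :
    matchesFrequency pts (entry S r) = true ↔
      frequency (fun ω => (multiplicity pts ω / D : ℝ)) S = (r.val : ℝ) := by
  have hden := r.den_pos
  rw [frequency_div, Fraction.val]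
  push_cast
  rw [div_eq_div_iff (by exact_mod_cast hpos.ne') (by exact_mod_cast hden.ne')]
  simp only [matchesFrequency, entry, List.headD_cons, List.tail_cons, ofBits_encodeNat,
    weight_itemsetBits h, hD, Bool.and_eq_true, Bool.not_eq_true', decide_eq_true_eq,
    decide_eq_false_iff_not, not_lt]
  generalize frequency (multiplicity pts) S = F
  constructor
  · rintro ⟨h0, h1⟩
    obtain ⟨n, hn⟩ := Int.eq_ofNat_of_zero_le h0
    rw [hn] at h1 ⊢
    exact_mod_cast h1
  · intro h1
    have h2 : (F : ℤ) * r.den = r.num * D := by exact_mod_cast h1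
    have h0 : 0 ≤ r.num := by
      by_contra hlt
      have : r.num * (D : ℤ) < 0 := mul_neg_of_neg_of_pos (not_le.1 hlt) (by exact_mod_cast hpos)
      have : (0 : ℤ) ≤ F * r.den := by positivity
      omega
    refine ⟨h0, ?_⟩
    zify
    rwa [abs_of_nonneg h0]

/-- As for equality, except that a negative threshold is always exceeded. -/
theorem exceedsFrequency_iff {K D : ℕ} {pts : List Entry} (h : ∀ e ∈ pts, e.1.length = K)
    (hD : weight [] pts = D) (hpos : 0 < D) (S : Finset (Fin K)) (r : Fraction) :
    exceedsFrequency pts (entry S r) = true ↔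
      (r.val : ℝ) < frequency (fun ω => (multiplicity pts ω / D : ℝ)) S := by
  have hden := r.den_pos
  rw [frequency_div, Fraction.val]
  push_cast
  rw [div_lt_div_iff₀ (by exact_mod_cast hden) (by exact_mod_cast hpos)]
  simp only [exceedsFrequency, entry, List.headD_cons, List.tail_cons, ofBits_encodeNat,
    weight_itemsetBits h, hD, Bool.or_eq_true, decide_eq_true_eq]
  generalize frequency (multiplicity pts) S = F
  have h2 : (r.num : ℝ) * D < F * r.den ↔ r.num * (D : ℤ) < F * r.den := by
    exact_mod_cast Iff.rfl
  rw [h2]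
  rcases lt_or_ge r.num 0 with h0 | h0
  · have h3 : r.num * (D : ℤ) < 0 := mul_neg_of_neg_of_pos h0 (by exact_mod_cast hpos)
    have h4 : (0 : ℤ) ≤ F * r.den := by positivity
    exact ⟨fun _ => by omega, fun _ => .inl h0⟩
  · zify
    rw [abs_of_nonneg h0]
    exact ⟨fun h => h.resolve_left (not_lt.2 h0), .inr⟩

theorem certifies_iff (I : QueryData) (pts : List Entry) :
    certifies I.entries pts = true ↔ 0 < weight [] pts ∧ (∀ e ∈ pts, e.1.length = I.K) ∧
      I.Satisfies (fun ω => (multiplicity pts ω / weight [] pts : ℝ)) ∧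
      (I.threshold.val : ℝ) <
        frequency (fun ω => (multiplicity pts ω / weight [] pts : ℝ)) I.query := by
  have hK : (I.entries.headD ([], [], [])).1.length = I.K := length_itemsetBits _
  simp only [certifies, hK]
  simp only [entries, Bool.and_eq_true, decide_eq_true_eq, List.all_eq_true,
    List.headD_cons, List.tail_cons, List.mem_ofFn', Set.forall_mem_range, and_assoc]
  refine and_congr_right fun hpos => and_congr_right fun hlen => and_congr ?_
    (exceedsFrequency_iff hlen rfl hpos _ _)
  simp only [matchesFrequency_iff hlen rfl hpos, Satisfies, stdSimplex]
  refine (and_iff_right ⟨fun ω => by positivity, ?_⟩).symm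
  rw [← Finset.sum_div, div_eq_one_iff_eq (by exact_mod_cast hpos.ne'), weight_nil I.K]
  push_cast
  rfl

theorem verifier_encode_iff (I : QueryData) (w : List Bool) :
    verifier (I.encode, w) = true ↔ (Function.Injective I.family ∧
      ∀ i, ∀ T ⊆ I.family i, ∃ j, I.family j = T) ∧ certifies I.entries (points w) = true := by
  simp only [verifier, wellFormed_encode, chunk_encode, Bool.true_and, Bool.and_eq_true,
    closedFamily_iff]

/-- Soundness. Consistency is not tested separately: the distribution that exceeds the threshold
also witnesses it. -/
theorem mem_of_verifier {x : List (Option Bool)} {w : List Bool} (h : verifier (x, w) = true) :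
    x ∈ MaxQueryDec := by
  have hx : wellFormed x = true := by
    simp only [verifier, Bool.and_eq_true] at h
    exact h.1
  obtain ⟨I, rfl⟩ := exists_encode_eq hx
  rw [verifier_encode_iff, certifies_iff] at h
  obtain ⟨⟨h1, h2⟩, -, -, h3, h4⟩ := h
  exact ⟨I, rfl, ⟨h1, h2, _, h3⟩, _, h3, h4⟩

/-! ### Certificates -/

/-- Two bits that stand for a bit or a separator. -/
def symbolBits : Option Bool → List Bool
  | none => [false, false]
  | some b => [true, b]

/-- The certificate that describes a list of outcomes with weights. -/
def certificate (pts : List Entry) : List Bool :=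
  ((((pts.map Entry.words).flatten.map encodeWord).flatten).map symbolBits).flatten

theorem points_certificate (pts : List Entry) : points (certificate pts) = pts := by
  have h : ∀ l : List (Option Bool),
      ((l.map symbolBits).flatten).foldr pairStep (none, []) = (none, l) := by
    intro l
    induction l with
    | nil => rfl
    | cons s l ih => cases s <;> simp [symbolBits, pairStep, ih]
  rw [points, certificate, h, parseWords_encode, chunk_words]

/-- An entry consists of three words with a separator each, and every symbol takes two bits. -/
theorem length_certificate_le {pts : List Entry} {c : ℕ}
    (h : ∀ e ∈ pts, e.1.length + e.2.1.length + e.2.2.length ≤ c) :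
    (certificate pts).length ≤ pts.length * (2 * (c + 3)) := by
  have hs : ∀ l : List (Option Bool), ((l.map symbolBits).flatten).length = 2 * l.length := by
    intro l
    induction l with
    | nil => rfl
    | cons s l ih =>
      have : (symbolBits s).length = 2 := by cases s <;> rfl
      simp only [List.map_cons, List.flatten_cons, List.length_append, ih, this, List.length_cons]
      ring
  rw [certificate, hs]
  induction pts with
  | nil => simp
  | cons e pts ih =>
    have h1 := ih fun e he => h e (List.mem_cons_of_mem _ he)
    have h2 := h e List.mem_cons_self
    simp only [List.map_cons, List.flatten_cons, List.map_append, List.flatten_append,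
      List.length_append, List.length_cons, Nat.succ_mul, Nat.mul_add] at h1 ⊢
    have h3 : ((e.words.map encodeWord).flatten).length =
        e.1.length + e.2.1.length + e.2.2.length + 3 := by
      simp [Entry.words, encodeWord]
      omega
    omega

theorem exists_points {K : ℕ} (n : (Fin K → Bool) → ℕ) : ∃ pts : List Entry,
    pts.length = (Finset.univ.filter fun ω => n ω ≠ 0).card ∧ multiplicity pts = n ∧
      ∀ e ∈ pts, e.1.length = K ∧ e.2.2 = [] ∧ ∃ ω, e.2.1 = (n ω).bits := by
  refine ⟨(Finset.univ.filter fun ω => n ω ≠ 0).toList.map fun ω => (List.ofFn ω, (n ω).bits, []),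
    by simp, ?_, by simp; exact fun ω _ => ⟨ω, rfl⟩⟩
  funext ω
  have h : ∀ ω' : Fin K → Bool, outcome K (List.ofFn ω', (n ω').bits, []) = ω' := by
    intro ω'
    funext a
    simp [outcome]
  rw [multiplicity, List.map_map]
  simp only [Function.comp_def, h, ofBits_bits, Finset.sum_map_toList]
  simp
  exact Eq.symm

/-- Completeness. The sparse optimum beats the threshold as soon as any distribution does. An entry
of its certificate needs `K` bits for the outcome and, the weight being at most `D`, no more bits
than `D` may have. -/
theorem exists_certificate {I : QueryData} (hI : I.IsInstance) {L : ℕ}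
    (hL : ∀ i, Nat.size (I.freq i).val.den ≤ L)
    (hyes : ∃ p, I.Satisfies p ∧ (I.threshold.val : ℝ) < frequency p I.query) :
    ∃ w : List Bool, w.length ≤
        (I.N + 1) * (2 * (I.K + (2 * (I.N + 1) ^ 2 + (I.N + L) ^ 2) + 3)) ∧
      verifier (I.encode, w) = true := by
  obtain ⟨D, n, hD, hopt, hcard, hle⟩ := exists_rational_optimum hI
  have hlt := denominator_lt hL hle
  have hsum := sum_eq_of_satisfies hD hopt.1
  obtain ⟨pts, hlen, rfl, hpts⟩ := exists_points n
  have hweight : weight [] pts = D := by rw [weight_nil I.K, hsum]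
  refine ⟨certificate pts, ?_, ?_⟩
  · refine (length_certificate_le (c := I.K + (2 * (I.N + 1) ^ 2 + (I.N + L) ^ 2))
      fun e he => ?_).trans (Nat.mul_le_mul_right _ (hlen ▸ hcard))
    obtain ⟨h1, h2, ω, h3⟩ := hpts e he
    rw [h1, h2, h3, Nat.size_eq_bits_len, List.length_nil]
    have h4 : multiplicity pts ω ≤ D := by
      rw [← hsum]
      exact Finset.single_le_sum (f := multiplicity pts) (fun _ _ => Nat.zero_le _)
        (Finset.mem_univ ω)
    have := Nat.size_le.2 (h4.trans_lt hlt)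
    omega
  · rw [verifier_encode_iff, certifies_iff, points_certificate, hweight]
    obtain ⟨p, hp, hp'⟩ := hyes
    exact ⟨⟨hI.distinct, hI.antimonotonic⟩, hD, fun e he => (hpts e he).1, hopt.1,
      hp'.trans_le (hopt.2 p hp)⟩

theorem length_lt_of_mem_words {I : QueryData} {w : List Bool} (h : w ∈ I.words) :
    w.length < I.encode.length := by
  have h1 : encodeWord w ∈ I.words.map encodeWord := List.mem_map_of_mem h
  have h2 := (List.sublist_flatten_of_mem h1).length_le
  rw [← encode] at h2
  simp [encodeWord] at h2
  omega

/-- The reduced denominator divides the one written in the string. -/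
theorem size_den_le (I : QueryData) (i : Fin I.N) :
    Nat.size (I.freq i).val.den ≤ I.encode.length := by
  have h1 : encodeNat (I.freq i).den ∈ I.words := by
    simp only [words, List.mem_append, List.mem_flatten, List.mem_ofFn']
    exact .inr ⟨_, ⟨i, rfl⟩, by simp [entryWords]⟩
  have h2 := length_lt_of_mem_words h1
  rw [encodeNat_eq_bits, Nat.size_eq_bits_len] at h2
  have h3 : (I.freq i).val.den ∣ (I.freq i).den := by
    have := Rat.den_dvd (I.freq i).num (I.freq i).den
    rw [Rat.divInt_eq_div] at this
    exact Int.natCast_dvd_natCast.1 this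
  exact (Nat.size_le_size (Nat.le_of_dvd (I.freq i).den_pos h3)).trans h2.le

theorem card_attributes_le (I : QueryData) : I.K ≤ I.encode.length := by
  have h1 : itemsetBits I.query ∈ I.words := by simp [words, entryWords]
  have h2 := length_lt_of_mem_words h1
  rw [length_itemsetBits] at h2
  exact h2.le

/-- Every word contributes at least its separator. -/
theorem card_family_le (I : QueryData) : I.N ≤ I.encode.length := by
  have h : ∀ ws : List (List Bool), ws.length ≤ ((ws.map encodeWord).flatten).length := by
    intro ws
    induction ws with
    | nil => simp
    | cons w ws ih => simp [encodeWord] at ih ⊢; omega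
  refine le_trans ?_ (h I.words)
  rw [words_eq, List.length_flatten, List.map_map]
  have : ∀ es : List Entry, es.length ≤ (es.map (List.length ∘ Entry.words)).sum := by
    intro es
    induction es with
    | nil => simp
    | cons e es ih => simp [Entry.words] at ih ⊢; omega
  refine le_trans ?_ (this _)
  simp [entries]

end QueryData

theorem inNP_maxQueryDec : InNP MaxQueryDec := by
  -- The bound for certificates, with the length of the input in place of `K`, `N` and `L`.
  refine ⟨verifier, (.X + 1) * (2 * (.X + (2 * (.X + 1) ^ 2 + (.X + .X) ^ 2) + 3)),
    PolyTime.verifier.tm2Computable, fun x => ⟨?_, fun ⟨w, _, hw⟩ => QueryData.mem_of_verifier hw⟩⟩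
  rintro ⟨I, rfl, hI, hyes⟩
  obtain ⟨w, hw, hV⟩ := QueryData.exists_certificate hI I.size_den_le hyes
  refine ⟨w, hw.trans ?_, hV⟩
  have h1 := I.card_attributes_le
  have h2 := I.card_family_le
  simp only [Polynomial.eval_mul, Polynomial.eval_add, Polynomial.eval_pow, Polynomial.eval_X,
    Polynomial.eval_one, Polynomial.eval_ofNat]
  gcongr

theorem theorem1 :
    InNP MaxQueryDec ∧
    ∃ P : Polynomial ℕ, ∀ I : QueryData, I.IsInstance →
      ∀ L : ℕ, (∀ i, Nat.size (I.freq i).val.den ≤ L) →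
        ∃ q : (Fin I.K → Bool) → ℚ,
          I.IsOptimal (fun ω => (q ω : ℝ)) ∧
          (Finset.univ.filter fun ω => q ω ≠ 0).card ≤ I.N + 1 ∧
          ∀ ω, Nat.size (q ω).den ≤ P.eval (I.N + L) ∧
            Nat.size (q ω).num.natAbs ≤ P.eval (I.N + L) := by
  -- The exponent from `denominator_lt`, with `N` replaced by `N + L` in the first summand.
  refine ⟨inNP_maxQueryDec, 2 * (.X + 1) ^ 2 + .X ^ 2, fun I hI L hL => ?_⟩
  obtain ⟨q, hopt, hcard, hsize⟩ := QueryData.exists_canonical_optimum hI hL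
  have hle : 2 * (I.N + 1) ^ 2 + (I.N + L) ^ 2 ≤
      (2 * (.X + 1) ^ 2 + .X ^ 2 : Polynomial ℕ).eval (I.N + L) := by
    simp only [Polynomial.eval_mul, Polynomial.eval_add, Polynomial.eval_pow, Polynomial.eval_X,
      Polynomial.eval_one, Polynomial.eval_ofNat]
    gcongr
    omega
  exact ⟨q, hopt, hcard, fun ω => ⟨(hsize ω).1.trans hle, (hsize ω).2.trans hle⟩⟩
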